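/- All graphs are finite, simple and undirected. For graphs $G$ and $F$, a spanning subgraph $H$ of $G$ is called $F$-saturated relative to $G$ if $H$ contains no (not necessarily induced) copy of $F$, but for every edge $e\in E(G)\setminus E(H)$ the graph $H+e$ contains a copy of $F$. Let $\mathrm{sat}(G,F)$ be the minimum number of edges of a graph that is $F$-saturated relative to $G$. Let $K_k^n$ be the complete $k$-partite graph with $n$ vertices in each part, and $C_\ell$ the cycle on $\ell$ vertices. For all integers $k\ge 4$ and $\ell\ge 60k+12$ there is an integer $N=N(k,\ell)$ such that for all $n\ge N$ $$\mathrm{sat}(K_k^n,C_\ell)\le k(n-1)+6\left\lceil \frac{\ell}{5}\right\rceil .$$ Moreover, for every integer $\ell\ge 192$ $(=60\cdot 3+12)$ there is an integer $N=N(\ell)$ such that for all $n\ge N$ $$\mathrm{sat}(K_3^n,C_\ell)\le 3n+13\left\lceil \frac{\ell}{5}\right\rceil .$$ -/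

import Mathlib

/-- `H` is a (spanning) subgraph of `G` that contains no copy of `F`, but adding to `H` any edge of
`G` that is not an edge of `H` creates a copy of `F`.  A copy is a not necessarily induced one. -/
structure IsSaturatedRel {V W : Type*} (G : SimpleGraph V) (F : SimpleGraph W)
    (H : SimpleGraph V) : Prop where
  le : H ≤ G
  free : F.Free H
  contained_add_edge : ∀ u v : V, G.Adj u v → ¬ H.Adj u v →
    F.IsContained (H ⊔ SimpleGraph.edge u v)

/-- The saturation number `sat(G, F)`: the least number of edges of an `F`-saturated subgraph
relative to `G`.  It takes values in `ℕ∞`, so that it is `⊤` if there is no such subgraph. -/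
noncomputable def satNumber {V W : Type*} (G : SimpleGraph V) (F : SimpleGraph W) : ℕ∞ :=
  ⨅ (H : SimpleGraph V) (_ : IsSaturatedRel G F H), H.edgeSet.encard

/-!
An explicit saturated graph with few edges is built for every `k ≥ 3`. Its core is a ring of `ℓ + 1`
layers. Most layers have two vertices, of colours `0` and `1`; three layers, the caps, are a single
vertex of colour `2`; and some layers, the wide ones, have one vertex of each colour. Two vertices of
the ring are adjacent if their colours differ and their layers are equal or cyclically consecutive,
so that away from the caps and the wide layers the ring is a ladder. The colours are three of the
parts, and a vertex of the ring has its layer as its index in the part. Every other vertex of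
part `i` is a leaf, attached to the hub of part `i`: a vertex of colour different from `i` in a wide
layer reserved for this part.

*No cycle on `ℓ` vertices* (`RingParams.false_of_cycle`). Such a cycle uses no leaf and misses one of
the `ℓ + 1` layers. Once the ring is cut open at that layer the caps are cut vertices, so the cycle
lies in a block between consecutive caps; but the first block has `ℓ - 1` vertices and the others
have fewer.

*Saturation* (`RingParams.hasPath_of_not_adj`). In a ladder each layer can be crossed with one vertex
or with two, and at a cap the parity becomes free. So two vertices in layers at distance `d ≥ 2` are
joined the long way around by paths with any number of vertices from `ℓ + 2 - d` up to `ℓ`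
(`RingParams.exists_path_around`). Ring vertices of different parts that are not adjacent have
`d ≥ 2`, which gives a path on `ℓ` vertices. Two hubs have `d ≥ 6`, which gives a path on `ℓ - 2`
vertices between them and serves two leaves. For a leaf and a ring vertex, a path on `ℓ - 1` vertices
from the hub to that vertex is needed; if `d ≤ 2` the long way around is too long for this, and a
Hamiltonian path of the first block takes its place (`RingParams.exists_hamiltonian_path`): the third
vertex of the wide layer makes it possible to cover first one side of that layer and then the other,
and to end at any prescribed vertex nearby.

*Edges* (`RingParams.card_edges_le`). Every vertex is charged with one edge, which leaves one edge per
layer and at most five for each cap and each wide layer: `k * n + ℓ + O(k)` edges in total.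
-/

/-! ### Paths with a prescribed number of vertices -/

/-- `HasPath G P u v n`: the graph `G` has a path from `u` to `v` with exactly `n` vertices, all of
which satisfy `P`. The path is recorded as the list of its vertices. -/
def HasPath {V : Type*} (G : SimpleGraph V) (P : V → Prop) (u v : V) (n : ℕ) : Prop :=
  ∃ l : List V, l.head? = some u ∧ l.getLast? = some v ∧ l.IsChain G.Adj ∧ l.Nodup ∧
    (∀ x ∈ l, P x) ∧ l.length = n

namespace HasPath

variable {V W : Type*} {G : SimpleGraph V} {P Q : V → Prop} {u v w z : V} {n m : ℕ}

theorem single (hu : P u) : HasPath G P u u 1 :=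
  ⟨[u], by simp [hu]⟩

theorem mono (h : HasPath G P u v n) (hPQ : ∀ x, P x → Q x) : HasPath G Q u v n := by
  obtain ⟨l, h1, h2, h3, h4, h5, h6⟩ := h
  exact ⟨l, h1, h2, h3, h4, fun x hx => hPQ x (h5 x hx), h6⟩

theorem congr_length (h : HasPath G P u v n) (hnm : n = m) : HasPath G P u v m := hnm ▸ h

theorem reverse (h : HasPath G P u v n) : HasPath G P v u n := by
  obtain ⟨l, h1, h2, h3, h4, h5, h6⟩ := h
  refine ⟨l.reverse, by simpa using h2, by simpa using h1, ?_, by simpa using h4,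
    by simpa using h5, by simpa using h6⟩
  rw [List.isChain_reverse]
  exact h3.imp fun a b hab => hab.symm

theorem append (h : HasPath G P u v n) (h' : HasPath G Q w z m) (hvw : G.Adj v w)
    (hPQ : ∀ x, P x → ¬ Q x) : HasPath G (fun x => P x ∨ Q x) u z (n + m) := by
  obtain ⟨l, h1, h2, h3, h4, h5, h6⟩ := h
  obtain ⟨l', h1', h2', h3', h4', h5', h6'⟩ := h'
  refine ⟨l ++ l', by simp [h1], by simp [h2'], ?_, ?_, ?_, by simp [h6, h6']⟩
  · rw [List.isChain_append]
    refine ⟨h3, h3', fun x hx y hy => ?_⟩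
    simp only [h2, h1', Option.mem_def, Option.some.injEq] at hx hy
    exact hx ▸ hy ▸ hvw
  · rw [List.nodup_append]
    exact ⟨h4, h4', fun a ha b hb hab => hPQ a (h5 a ha) (hab ▸ h5' b hb)⟩
  · intro x hx
    rcases List.mem_append.1 hx with hx | hx
    · exact .inl (h5 x hx)
    · exact .inr (h5' x hx)

/-- Extension of a path at its last vertex. -/
theorem snoc (h : HasPath G P u v n) (hvw : G.Adj v w) (hw : ¬ P w) :
    HasPath G (fun x => P x ∨ x = w) u w (n + 1) :=
  h.append (single (P := fun x => x = w) rfl) hvw fun _ hx hxw => hw (hxw ▸ hx)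

/-- Extension of a path at its first vertex. -/
theorem cons (h : HasPath G P u v n) (hwu : G.Adj w u) (hw : ¬ P w) :
    HasPath G (fun x => P x ∨ x = w) w v (n + 1) :=
  (h.reverse.snoc hwu.symm hw).reverse

theorem map {H : SimpleGraph W} (f : V → W) (h : HasPath G P u v n) {R : W → Prop}
    (hf : ∀ x y, P x → P y → G.Adj x y → H.Adj (f x) (f y))
    (hinj : ∀ x y, P x → P y → f x = f y → x = y) (hR : ∀ x, P x → R (f x)) :
    HasPath H R (f u) (f v) n := by
  obtain ⟨l, h1, h2, h3, h4, h5, h6⟩ := h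
  refine ⟨l.map f, by simp [h1], by simp [h2], ?_, ?_, ?_, by simpa using h6⟩
  · rw [List.isChain_map]
    exact h3.imp_of_mem_imp fun a b ha hb hab => hf a b (h5 a ha) (h5 b hb) hab
  · exact h4.map_on fun x hx y hy hxy => hinj x y (h5 x hx) (h5 y hy) hxy
  · intro y hy
    obtain ⟨x, hx, rfl⟩ := List.mem_map.1 hy
    exact hR x (h5 x hx)

/-- A path on `n` vertices is closed to a cycle on `n` vertices by the edge joining its ends. -/
theorem cycleGraph_isContained_sup_edge (h : HasPath G P u v n) (huv : u ≠ v) :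
    (SimpleGraph.cycleGraph n).IsContained (G ⊔ SimpleGraph.edge u v) := by
  obtain ⟨l, h1, h2, h3, h4, h5, rfl⟩ := h
  have hne : l ≠ [] := by rintro rfl; simp at h1
  have hpos : 0 < l.length := List.length_pos_iff.2 hne
  have hhead : l[0] = u := by
    rw [List.head?_eq_getElem?, List.getElem?_eq_getElem hpos] at h1
    simpa using h1
  have hlast : l[l.length - 1]'(by omega) = v := by
    rw [List.getLast?_eq_getElem?, List.getElem?_eq_getElem (by omega)] at h2
    simpa using h2
  have hstep : ∀ i (hi : i + 1 < l.length), G.Adj l[i] l[i + 1] :=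
    fun i hi => List.isChain_iff_getElem.1 h3 i hi
  have hadj : ∀ a b : Fin l.length, (b : ℕ) = (a + 1) % l.length → a ≠ b →
      (G ⊔ SimpleGraph.edge u v).Adj l[a] l[b] := by
    intro a b hab hne
    rw [SimpleGraph.sup_adj]
    by_cases hlt : (a : ℕ) + 1 < l.length
    · rw [Nat.mod_eq_of_lt hlt] at hab
      left
      have := hstep a hlt
      simpa [← hab] using this
    · have ha : (a : ℕ) = l.length - 1 := by omega
      have hb : (b : ℕ) = 0 := by
        rw [hab, ha, Nat.sub_add_cancel hpos, Nat.mod_self]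
      right
      have e1 : l[a] = v := by simpa [ha] using hlast
      have e2 : l[b] = u := by simpa [hb] using hhead
      rw [e1, e2, SimpleGraph.edge_adj]
      exact ⟨.inr ⟨rfl, rfl⟩, huv.symm⟩
  refine ⟨⟨⟨fun i => l[i], ?_⟩, ?_⟩⟩
  · intro a b hab
    have hne' := hab.ne
    obtain ⟨N, hN⟩ : ∃ N, l.length = N + 1 := ⟨l.length - 1, by omega⟩
    have key : ∀ (M : ℕ) (hM : M = N + 1) (a b : Fin M), (SimpleGraph.cycleGraph M).Adj a b →
        (b : ℕ) = (a + 1) % M ∨ (a : ℕ) = (b + 1) % M := by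
      rintro M rfl a b hab
      rw [SimpleGraph.cycleGraph_eq_circulantGraph] at hab
      simp only [SimpleGraph.circulantGraph_adj, Set.mem_singleton_iff] at hab
      rcases hab.2 with h | h
      · right
        have : a = b + 1 := by rw [← h]; abel
        rw [this, Fin.val_add]
        simp
      · left
        have : b = a + 1 := by rw [← h]; abel
        rw [this, Fin.val_add]
        simp
    rcases key _ hN a b hab with h | h
    · exact hadj a b h hne'
    · exact (hadj b a h hne'.symm).symm
  · intro a b hab
    exact Fin.ext ((List.Nodup.getElem_inj_iff h4).1 hab)

end HasPath

/-- A copy of a cycle on `m` vertices is a periodic sequence of vertices. -/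
theorem exists_periodic_of_cycleGraph_isContained {V : Type*} {G : SimpleGraph V} {m : ℕ}
    (hm : 3 ≤ m) (h : (SimpleGraph.cycleGraph m).IsContained G) :
    ∃ g : ℕ → V, (∀ i, G.Adj (g i) (g (i + 1))) ∧ (∀ i, g (i + m) = g i) ∧
      ∀ i j, g i = g j → i % m = j % m := by
  obtain ⟨f⟩ := h
  obtain ⟨N, rfl⟩ : ∃ N, m = N + 1 := ⟨m - 1, by omega⟩
  refine ⟨fun i => f (Fin.ofNat (N + 1) i), fun i => f.toHom.map_adj ?_, fun i => ?_,
    fun i j hij => ?_⟩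
  · rw [SimpleGraph.cycleGraph_eq_circulantGraph]
    have e : (Fin.ofNat (N + 1) (i + 1)) = Fin.ofNat (N + 1) i + 1 := by
      apply Fin.ext
      simp [Fin.val_add]
    rw [e]
    refine ⟨fun h => ?_, .inr (by simp)⟩
    have h1 : (1 : Fin (N + 1)) = 0 := by simpa using h
    have h2 := congrArg Fin.val h1
    rw [Fin.val_one', Fin.val_zero, Nat.mod_eq_of_lt (by omega)] at h2
    omega
  · have e : Fin.ofNat (N + 1) (i + (N + 1)) = Fin.ofNat (N + 1) i := Fin.ext (by simp)
    simp only [e]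
  · have := f.injective hij
    simpa using congrArg Fin.val this

/-! ### The layered ring -/

/-- Parameters of the ring: `ℓ` is the length of the forbidden cycle and `ℓ + 1` the number of
layers, `κ` is the number of wide layers, and the layers `0`, `q + 1` and `C` are the caps. By
`size`, the layers from `0` to `q + 1` have exactly `ℓ - 1` vertices altogether; by `room`, the wide
layers `6, 12, …, 6 * κ` lie well inside this range. By `cap_lower` and `cap_upper`, the other two
stretches between consecutive caps are shorter than half of the ring, by at least two layers. -/
structure RingParams where
  ℓ : ℕ
  κ : ℕ
  q : ℕ
  C : ℕ
  size : 2 * q + κ + 3 = ℓ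
  two_le : 2 ≤ κ
  room : 6 * κ + 6 ≤ q
  cap_lower : ℓ + 5 ≤ 2 * C
  cap_upper : 2 * C + 1 ≤ ℓ + 2 * q

namespace RingParams

variable (D : RingParams)

/-- The number of layers of the ring. -/
def layers : ℕ := D.ℓ + 1

/-- Layers consisting of a single vertex, of colour `2`. -/
def IsCap (j : ℕ) : Prop := j = 0 ∨ j = D.q + 1 ∨ j = D.C

/-- Layers consisting of three vertices, one of each colour. -/
def IsWide (j : ℕ) : Prop := j % 6 = 0 ∧ 0 < j ∧ j ≤ 6 * D.κ

instance (j : ℕ) : Decidable (D.IsCap j) := by unfold IsCap; infer_instance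

instance (j : ℕ) : Decidable (D.IsWide j) := by unfold IsWide; infer_instance

/-- `D.Mem j c`: layer `j < D.layers` contains a vertex of colour `c`. A layer that is neither a
cap nor wide has the colours `0` and `1`. -/
def Mem (j c : ℕ) : Prop := (c ≤ 1 ∧ ¬ D.IsCap j) ∨ (c = 2 ∧ (D.IsCap j ∨ D.IsWide j))

instance (j c : ℕ) : Decidable (D.Mem j c) := by unfold Mem; infer_instance

theorem not_isCap_of_isWide {j : ℕ} (h : D.IsWide j) : ¬ D.IsCap j := by
  have h1 := D.size; have h2 := D.room; have h3 := D.cap_lower; have h4 := D.cap_upper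
  unfold IsWide at h
  unfold IsCap
  omega

theorem layer_add_mod (t i : ℕ) : (D.layers * t + i) % D.layers = i % D.layers := by
  simp [Nat.add_comm, Nat.add_mul_mod_self_left]

theorem exists_residue (j : ℕ) : ∃ r, r < D.layers ∧ j % D.layers = r ∧
    ((j + 1) % D.layers = r + 1 ∧ r + 1 < D.layers ∨
      (j + 1) % D.layers = 0 ∧ r + 1 = D.layers) := by
  have hL : 0 < D.layers := Nat.succ_pos _
  have hr := Nat.mod_lt j hL
  refine ⟨j % D.layers, hr, rfl, ?_⟩
  rw [Nat.add_mod]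
  have h1 : 1 % D.layers = 1 := Nat.mod_eq_of_lt (by
    have := D.size; unfold layers; omega)
  rw [h1]
  by_cases h : j % D.layers + 1 < D.layers
  · exact .inl ⟨Nat.mod_eq_of_lt h, h⟩
  · right
    have : j % D.layers + 1 = D.layers := by omega
    exact ⟨by rw [this, Nat.mod_self], this⟩

/-- A vertex of the universal cover of the ring: the layer is any natural number, taken modulo the
number of layers. -/
def Core (p : ℕ × ℕ) : Prop := D.Mem (p.1 % D.layers) p.2

/-- The vertices of the cover outside of the wide layers together with those of colour `0` or `1` in
the wide layers. -/
def Main (p : ℕ × ℕ) : Prop :=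
  (D.IsCap (p.1 % D.layers) ∧ p.2 = 2) ∨ (¬ D.IsCap (p.1 % D.layers) ∧ p.2 ≤ 1)

theorem Main.core {D : RingParams} {p : ℕ × ℕ} (h : D.Main p) : D.Core p := by
  rcases h with h | h
  · exact .inr ⟨h.2, .inl h.1⟩
  · exact .inl ⟨h.2, h.1⟩

theorem main_or_wide {D : RingParams} {p : ℕ × ℕ} (h : D.Core p) :
    D.Main p ∨ (D.IsWide (p.1 % D.layers) ∧ p.2 = 2) := by
  rcases h with h | ⟨h, h' | h'⟩
  · exact .inl (.inr ⟨h.2, h.1⟩)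
  · exact .inl (.inl ⟨h', h⟩)
  · exact .inr ⟨h', h⟩

theorem not_isCap_succ (j : ℕ) (h : D.IsCap (j % D.layers)) :
    ¬ D.IsCap ((j + 1) % D.layers) := by
  have h1 := D.size; have h2 := D.room; have h3 := D.cap_lower; have h4 := D.cap_upper
  obtain ⟨r, hr, e, h5⟩ := D.exists_residue j
  rw [e] at h
  have hL : D.layers = D.ℓ + 1 := rfl
  rcases h5 with ⟨h5, h6⟩ | ⟨h5, h6⟩ <;> rw [h5] <;> unfold IsCap at h ⊢ <;> omega

theorem not_isCap_of_isWide_succ (j : ℕ) (h : D.IsWide ((j + 1) % D.layers)) :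
    ¬ D.IsCap (j % D.layers) := by
  have h1 := D.size; have h2 := D.room; have h3 := D.cap_lower; have h4 := D.cap_upper
  obtain ⟨r, hr, e, h5⟩ := D.exists_residue j
  rw [e]
  have hL : D.layers = D.ℓ + 1 := rfl
  rcases h5 with ⟨h5, h6⟩ | ⟨h5, h6⟩ <;> rw [h5] at h <;> unfold IsWide at h <;>
    unfold IsCap <;> omega

theorem not_isCap_succ_of_isWide (j : ℕ) (h : D.IsWide (j % D.layers)) :
    ¬ D.IsCap ((j + 1) % D.layers) := by
  have h1 := D.size; have h2 := D.room; have h3 := D.cap_lower; have h4 := D.cap_upper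
  obtain ⟨r, hr, e, h5⟩ := D.exists_residue j
  rw [e] at h
  have hL : D.layers = D.ℓ + 1 := rfl
  rcases h5 with ⟨h5, h6⟩ | ⟨h5, h6⟩ <;> rw [h5] <;> unfold IsWide at h <;>
    unfold IsCap <;> omega

end RingParams

/-- The graph on layers and colours: vertices are adjacent if their colours differ and their layers
are equal or consecutive. -/
def layerGraph : SimpleGraph (ℕ × ℕ) where
  Adj p p' := p.2 ≠ p'.2 ∧ p.1 ≤ p'.1 + 1 ∧ p'.1 ≤ p.1 + 1
  symm := ⟨fun _ _ h => ⟨h.1.symm, h.2.2, h.2.1⟩⟩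
  loopless := ⟨fun _ h => h.1 rfl⟩

namespace RingParams

variable (D : RingParams)

/-! ### Climbing paths -/

/-- The largest number of vertices that a climbing path visits in a layer. -/
def weight (j : ℕ) : ℕ := if D.IsCap (j % D.layers) then 1 else 2

/-- A path of main vertices from `(j, x)` to `(j + m, y)` with `n` vertices that stays in the layers
from `j` to `j + m`. -/
abbrev Climb (j x m y n : ℕ) : Prop :=
  HasPath layerGraph (fun p => D.Main p ∧ j ≤ p.1 ∧ p.1 ≤ j + m) (j, x) (j + m, y) n

variable {D}

theorem Climb.step {j x m y n y' : ℕ} (h : D.Climb j x m y n) (hy : D.Main (j + m + 1, y'))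
    (hne : y ≠ y') : D.Climb j x (m + 1) y' (n + 1) := by
  refine (HasPath.snoc (w := (j + m + 1, y')) h ⟨hne, by simp; omega, by simp⟩
    (fun hc => by have := hc.2.2; simp at this)).mono ?_
  rintro p (⟨h1, h2, h3⟩ | rfl)
  · exact ⟨h1, h2, by omega⟩
  · exact ⟨hy, by simp; omega, by simp [Nat.add_assoc]⟩

theorem Climb.step_two {j x m y n y' y'' : ℕ} (h : D.Climb j x m y n)
    (hy : D.Main (j + m + 1, y')) (hy' : D.Main (j + m + 1, y'')) (hne : y ≠ y')
    (hne' : y' ≠ y'') : D.Climb j x (m + 1) y'' (n + 2) := by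
  refine (HasPath.snoc (w := (j + m + 1, y''))
    (HasPath.snoc (w := (j + m + 1, y')) h ⟨hne, by simp; omega, by simp⟩
    (fun hc => by have := hc.2.2; simp at this)) ⟨hne', by simp, by simp⟩ ?_).mono ?_
  · rintro (⟨-, -, h⟩ | h)
    · simp at h
    · exact hne' (by simpa using h.symm)
  · rintro p ((⟨h1, h2, h3⟩ | rfl) | rfl)
    · exact ⟨h1, h2, by omega⟩
    · exact ⟨hy, by simp; omega, by simp [Nat.add_assoc]⟩
    · exact ⟨hy', by simp; omega, by simp [Nat.add_assoc]⟩

/-- Climbing paths before a cap is met: every layer is crossed either with a change of colour and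
one vertex, or without and with two vertices. Hence the parity of the number of vertices plus the
last colour is fixed, and the range of lengths has no other gaps. -/
theorem climb_of_forall_not_isCap {j x : ℕ} (hx : x ≤ 1) (m : ℕ)
    (hcap : ∀ i ≤ m, ¬ D.IsCap ((j + i) % D.layers)) (y n : ℕ) (hy : y ≤ 1) (h1 : m + 1 ≤ n)
    (h2 : n ≤ 2 * m + 2) (hpar : (n + y) % 2 = (1 + x) % 2) : D.Climb j x m y n := by
  have main : ∀ i ≤ m, ∀ c ≤ 1, D.Main (j + i, c) := fun i hi c hc => .inr ⟨hcap i hi, hc⟩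
  induction m generalizing y n with
  | zero =>
    have s : D.Climb j x 0 x 1 := HasPath.single ⟨main 0 le_rfl x hx, by simp, by simp⟩
    obtain rfl | rfl : n = 1 ∨ n = 2 := by omega
    · obtain rfl : y = x := by omega
      exact s
    · have hne : x ≠ y := by omega
      refine (HasPath.snoc (w := (j, y)) (HasPath.single (G := layerGraph)
        (P := fun p => p = (j, x)) rfl)
        ⟨hne, by simp, by simp⟩ (by simpa using hne.symm)).mono ?_
      rintro p (rfl | rfl)
      · exact ⟨main 0 le_rfl x hx, by simp, by simp⟩
      · exact ⟨main 0 le_rfl y hy, by simp, by simp⟩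
  | succ m ih =>
    have ih' := fun y n hy h1 h2 hp => ih (fun i hi => hcap i (by omega)) y n hy h1 h2 hp
      (fun i hi => main i (by omega))
    by_cases hn : n ≤ 2 * m + 3
    · obtain ⟨n, rfl⟩ : ∃ n', n = n' + 1 := ⟨n - 1, by omega⟩
      exact Climb.step (ih' (1 - y) n (by omega) (by omega) (by omega) (by omega))
        (main (m + 1) le_rfl y hy) (by omega)
    · obtain rfl : n = 2 * m + 2 + 2 := by omega
      exact Climb.step_two (ih' y (2 * m + 2) hy (by omega) (by omega) (by omega))
        (main (m + 1) le_rfl (1 - y) (by omega)) (main (m + 1) le_rfl y hy) (by omega) (by omega)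

theorem sum_weight_of_forall_not_isCap {j : ℕ} (m : ℕ)
    (hcap : ∀ i ≤ m, ¬ D.IsCap ((j + i) % D.layers)) :
    ∑ i ∈ Finset.range (m + 1), D.weight (j + i) = 2 * m + 2 := by
  rw [Finset.sum_congr rfl (g := fun _ => 2)]
  · simp; ring
  · intro i hi
    exact if_neg (hcap i (by simpa [Nat.lt_succ_iff] using hi))

theorem le_sum_weight (j m : ℕ) :
    m + 1 ≤ ∑ i ∈ Finset.range (m + 1), D.weight (j + i) := by
  have : ∑ i ∈ Finset.range (m + 1), 1 ≤ ∑ i ∈ Finset.range (m + 1), D.weight (j + i) :=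
    Finset.sum_le_sum fun i _ => by unfold weight; split <;> omega
  simpa using this

/-- Climbing paths that meet a cap: since both colours are available next to the cap, all lengths
in the range occur. -/
theorem climb_of_exists_isCap {j x : ℕ} (hx : D.Main (j, x)) (m : ℕ)
    (hcap : ∃ i ≤ m, D.IsCap ((j + i) % D.layers)) (y n : ℕ) (hy : D.Main (j + m, y))
    (h1 : m + 1 ≤ n) (h2 : n ≤ ∑ i ∈ Finset.range (m + 1), D.weight (j + i)) :
    D.Climb j x m y n := by
  induction m generalizing y n with
  | zero =>
    obtain ⟨i, hi, hc⟩ := hcap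
    obtain rfl : i = 0 := by omega
    rw [Nat.add_zero] at hc
    rcases hx with hx | hx
    · rcases hy with hy | hy
      · obtain rfl : x = y := hx.2.trans hy.2.symm
        have : n = 1 := by
          simp only [zero_add, Finset.range_one, Finset.sum_singleton, Nat.add_zero, weight,
            if_pos hc] at h2
          omega
        subst this
        exact HasPath.single ⟨.inl hx, by simp, by simp⟩
      · exact absurd hc (by simpa using hy.1)
    · exact absurd hc hx.1
  | succ m ih =>
    rw [Finset.sum_range_succ] at h2
    have hle := le_sum_weight (D := D) j m
    by_cases hprev : ∃ i ≤ m, D.IsCap ((j + i) % D.layers)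
    · rcases hy with hy | hy
      · -- the new layer is a cap
        have hnc : ¬ D.IsCap ((j + m) % D.layers) := fun h =>
          D.not_isCap_succ (j + m) h (by simpa [Nat.add_assoc] using hy.1)
        have hw : D.weight (j + (m + 1)) = 1 := if_pos hy.1
        obtain ⟨n, rfl⟩ : ∃ n', n = n' + 1 := ⟨n - 1, by omega⟩
        obtain rfl : y = 2 := hy.2
        exact Climb.step (ih hprev 0 n (.inr ⟨hnc, by simp⟩) (by omega) (by omega)) (.inl hy)
          (by omega)
      · have hw : D.weight (j + (m + 1)) = 2 := if_neg hy.1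
        have hy1 : y ≤ 1 := hy.2
        have hmain : ∀ c ≤ 1, D.Main (j + m + 1, c) := fun c hc => .inr ⟨hy.1, hc⟩
        by_cases hc : D.IsCap ((j + m) % D.layers)
        · by_cases hn : n ≤ ∑ i ∈ Finset.range (m + 1), D.weight (j + i) + 1
          · obtain ⟨n, rfl⟩ : ∃ n', n = n' + 1 := ⟨n - 1, by omega⟩
            exact Climb.step (ih hprev 2 n (.inl ⟨hc, rfl⟩) (by omega) (by omega))
              (hmain y hy1) (by omega)
          · obtain ⟨n, rfl⟩ : ∃ n', n = n' + 2 := ⟨n - 2, by omega⟩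
            exact Climb.step_two (ih hprev 2 n (.inl ⟨hc, rfl⟩) (by omega) (by omega))
              (hmain (1 - y) (by omega)) (hmain y hy1) (by omega) (by omega)
        · by_cases hn : n ≤ ∑ i ∈ Finset.range (m + 1), D.weight (j + i) + 1
          · obtain ⟨n, rfl⟩ : ∃ n', n = n' + 1 := ⟨n - 1, by omega⟩
            exact Climb.step (ih hprev (1 - y) n (.inr ⟨hc, by simp⟩) (by omega) (by omega))
              (hmain y hy1) (by omega)
          · obtain ⟨n, rfl⟩ : ∃ n', n = n' + 2 := ⟨n - 2, by omega⟩
            exact Climb.step_two (ih hprev y n (.inr ⟨hc, hy1⟩) (by omega) (by omega))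
              (hmain (1 - y) (by omega)) (hmain y hy1) (by omega) (by omega)
    · -- the new layer is the first cap, and its predecessor is entered with the right parity
      push Not at hprev
      have hc : D.IsCap ((j + (m + 1)) % D.layers) := by
        obtain ⟨i, hi, hc⟩ := hcap
        by_cases him : i ≤ m
        · exact absurd hc (hprev i him)
        · obtain rfl : i = m + 1 := by omega
          exact hc
      have hw : D.weight (j + (m + 1)) = 1 := if_pos hc
      rw [sum_weight_of_forall_not_isCap m hprev] at h2
      have hx1 : x ≤ 1 := by
        rcases hx with hx | hx
        · exact absurd hx.1 (by simpa using hprev 0 (Nat.zero_le _))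
        · exact hx.2
      obtain rfl : y = 2 := by
        rcases hy with hy | hy
        · exact hy.2
        · exact absurd hc hy.1
      obtain ⟨n, rfl⟩ : ∃ n', n = n' + 1 := ⟨n - 1, by omega⟩
      have hmod : (n + (n + 1 + x) % 2) % 2 = (1 + x) % 2 := by omega
      exact Climb.step (climb_of_forall_not_isCap hx1 m hprev _ n (by omega) (by omega) (by omega)
        hmod) hy (by omega)

/-- Any window of at least half of the layers, up to a small constant, contains a cap. -/
theorem exists_isCap (j m : ℕ) (hm : D.layers ≤ 2 * m + 4) :
    ∃ i ≤ m, D.IsCap ((j + i) % D.layers) := by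
  have h1 := D.size; have h2 := D.room; have h3 := D.cap_lower; have h4 := D.cap_upper
  have h5 := D.two_le
  have hL : D.layers = D.ℓ + 1 := rfl
  have hdiv := Nat.div_add_mod j D.layers
  have hr := Nat.mod_lt j (show 0 < D.layers by omega)
  set r := j % D.layers
  set t := D.layers * (j / D.layers)
  have key : ∀ i s, r + i = s → (j + i) % D.layers = s % D.layers := by
    intro i s his
    rw [← hdiv, Nat.add_assoc, his, D.layer_add_mod]
  by_cases c1 : r ≤ D.q + 1
  · refine ⟨D.q + 1 - r, by omega, ?_⟩
    rw [key _ (D.q + 1) (by omega), Nat.mod_eq_of_lt (by omega)]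
    exact .inr (.inl rfl)
  · by_cases c2 : r ≤ D.C
    · refine ⟨D.C - r, by omega, ?_⟩
      rw [key _ D.C (by omega), Nat.mod_eq_of_lt (by omega)]
      exact .inr (.inr rfl)
    · refine ⟨D.layers - r, by omega, ?_⟩
      rw [key _ D.layers (by omega), Nat.mod_self]
      exact .inl rfl

theorem eq_of_add_mod_layers {j i i' : ℕ} (h : (j + i) % D.layers = (j + i') % D.layers)
    (hi : i < D.layers) (hi' : i' < D.layers) : i = i' :=
  Nat.ModEq.eq_of_lt_of_lt (Nat.ModEq.add_left_cancel' j h) hi hi'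

/-- A window of at most all layers has at most three caps. -/
theorem le_sum_weight_of_le_layers (j m : ℕ) (hm : m + 1 ≤ D.layers) :
    2 * m ≤ ∑ i ∈ Finset.range (m + 1), D.weight (j + i) + 1 := by
  have h1 : ∑ i ∈ Finset.range (m + 1), D.weight (j + i) +
      ((Finset.range (m + 1)).filter fun i => D.IsCap ((j + i) % D.layers)).card
      = 2 * (m + 1) := by
    rw [Finset.card_filter, ← Finset.sum_add_distrib, Finset.sum_congr rfl (g := fun _ => 2)]
    · simp; ring
    · intro i _
      unfold weight
      split <;> rfl
  have h2 : ((Finset.range (m + 1)).filter fun i => D.IsCap ((j + i) % D.layers)).card ≤ 3 := by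
    refine (Finset.card_le_card_of_injOn (t := {0, D.q + 1, D.C})
      (fun i => (j + i) % D.layers) ?_ ?_).trans Finset.card_le_three
    · intro i hi
      have := (Finset.mem_filter.1 hi).2
      simpa [IsCap] using this
    · intro i hi i' hi' h
      have e1 := Finset.mem_range.1 (Finset.mem_filter.1 hi).1
      have e2 := Finset.mem_range.1 (Finset.mem_filter.1 hi').1
      exact eq_of_add_mod_layers h (by omega) (by omega)
  omega

theorem main_climb {j x m y n : ℕ} (hx : D.Main (j, x)) (hy : D.Main (j + m, y))
    (hm : D.layers ≤ 2 * m + 4) (hm' : m + 1 ≤ D.layers) (h1 : m + 1 ≤ n) (h2 : n + 1 ≤ 2 * m) :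
    D.Climb j x m y n :=
  climb_of_exists_isCap hx m (exists_isCap j m hm) y n hy h1
    (by have := le_sum_weight_of_le_layers (D := D) j m hm'; omega)

/-- Paths that go around the ring. A vertex of colour `2` in a wide layer is reached through its own
layer, or through the adjacent layer if the path has no vertices to spare. -/
theorem exists_path_around {j c m c' n : ℕ} (hu : D.Core (j, c)) (hv : D.Core (j + m, c'))
    (hm : D.layers ≤ 2 * m) (hm' : m + 2 ≤ D.layers) (h1 : m + 1 ≤ n) (h2 : n + 1 ≤ 2 * m) :
    HasPath layerGraph (fun p => D.Core p ∧ j ≤ p.1 ∧ p.1 ≤ j + m) (j, c) (j + m, c') n := by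
  have hsize := D.size; have hroom := D.room; have hκ := D.two_le
  have hL : D.layers = D.ℓ + 1 := rfl
  -- the end `(j + m, c')` is an arbitrary vertex, the start is a main one
  have key : ∀ j x m n, D.Main (j, x) → D.Core (j + m, c') → D.layers ≤ 2 * m + 2 →
      m + 2 ≤ D.layers → m + 1 ≤ n → n + 1 ≤ 2 * m →
      HasPath layerGraph (fun p => (D.Main p ∨ p = (j + m, c')) ∧ j ≤ p.1 ∧ p.1 ≤ j + m)
        (j, x) (j + m, c') n := by
    intro j x m n hx hv hm hm' h1 h2
    rcases main_or_wide hv with hv' | ⟨hw, rfl⟩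
    · exact (main_climb hx hv' (by omega) (by omega) h1 h2).mono fun p hp => ⟨.inl hp.1, hp.2⟩
    · have hnot : ¬ D.Main (j + m, 2) := by
        rintro (h | h)
        · exact D.not_isCap_of_isWide hw h.1
        · exact absurd h.2 (by simp)
      obtain ⟨n, rfl⟩ : ∃ n', n = n' + 1 := ⟨n - 1, by omega⟩
      obtain ⟨m, rfl⟩ : ∃ m', m = m' + 1 := ⟨m - 1, by omega⟩
      by_cases hn : n = m + 1
      · have hnc : ¬ D.IsCap ((j + m) % D.layers) := D.not_isCap_of_isWide_succ (j + m) hw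
        refine (HasPath.snoc (w := (j + (m + 1), 2)) (main_climb (y := 0) (n := n) hx
          (.inr ⟨hnc, by simp⟩) (by omega) (by omega) (by omega) (by omega))
          ⟨by simp, by simp; omega, by simp; omega⟩ (fun h => hnot h.1)).mono ?_
        rintro p (⟨h, h', h''⟩ | rfl)
        · exact ⟨.inl h, h', by omega⟩
        · exact ⟨.inr rfl, by simp, by simp⟩
      · refine (HasPath.snoc (w := (j + (m + 1), 2)) (main_climb (y := 0) (n := n) hx
          (.inr ⟨D.not_isCap_of_isWide hw, by simp⟩) (by omega) (by omega) (by omega) (by omega))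
          ⟨by simp, by simp, by simp⟩ (fun h => hnot h.1)).mono ?_
        rintro p (⟨h, h', h''⟩ | rfl)
        · exact ⟨.inl h, h', by omega⟩
        · exact ⟨.inr rfl, by simp, by simp⟩
  have core : ∀ p, D.Main p ∨ p = (j + m, c') → D.Core p := by
    rintro p (h | rfl)
    · exact h.core
    · exact hv
  rcases main_or_wide hu with hu' | ⟨hw, rfl⟩
  · exact (key j c m n hu' hv (by omega) hm' h1 h2).mono fun p hp => ⟨core p hp.1, hp.2⟩
  · have hnot : ¬ (D.Main (j, 2) ∨ (j, 2) = (j + m, c')) := by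
      rintro ((h | h) | h)
      · exact D.not_isCap_of_isWide hw h.1
      · exact absurd h.2 (by simp)
      · have := congrArg Prod.fst h
        simp at this
        omega
    obtain ⟨n, rfl⟩ : ∃ n', n = n' + 1 := ⟨n - 1, by omega⟩
    by_cases hn : n = m
    · obtain ⟨m, rfl⟩ : ∃ m', m = m' + 1 := ⟨m - 1, by omega⟩
      have hnc : ¬ D.IsCap ((j + 1) % D.layers) := D.not_isCap_succ_of_isWide j hw
      have e : j + (m + 1) = j + 1 + m := by omega
      rw [e] at hv hnot core ⊢
      refine (HasPath.cons (w := (j, 2)) (key (j + 1) 0 m n (.inr ⟨hnc, by simp⟩) hv (by omega)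
        (by omega) (by omega) (by omega)) ⟨by simp, by simp; omega, by simp⟩
        (fun h => hnot h.1)).mono ?_
      rintro p (⟨h, h', h''⟩ | rfl)
      · exact ⟨core p h, by omega, by omega⟩
      · exact ⟨hu, by simp, by simp; omega⟩
    · refine (HasPath.cons (w := (j, 2)) (key j 0 m n
        (.inr ⟨D.not_isCap_of_isWide hw, by simp⟩) hv (by omega)
        (by omega) (by omega) (by omega)) ⟨by simp, by simp, by simp⟩
        (fun h => hnot h.1)).mono ?_
      rintro p (⟨h, h', h''⟩ | rfl)
      · exact ⟨core p h, h', h''⟩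
      · exact ⟨hu, by simp, by simp⟩

end RingParams

namespace RingParams

variable {D : RingParams}

/-! ### Hamiltonian paths of the first block -/

theorem core_iff {j c : ℕ} (hj : j < D.layers) : D.Core (j, c) ↔ D.Mem j c := by
  unfold Core
  rw [Nat.mod_eq_of_lt hj]

variable (D) in
/-- The number of vertices in a layer. -/
def layerSize (j : ℕ) : ℕ := if D.IsCap j then 1 else if D.IsWide j then 3 else 2

theorem not_isCap_of_le {j : ℕ} (h : 1 ≤ j) (h' : j ≤ D.q) : ¬ D.IsCap j := by
  have h1 := D.size; have h2 := D.room; have h3 := D.cap_lower; have h4 := D.cap_upper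
  unfold IsCap
  omega

theorem core_of_le {j c : ℕ} (h : 1 ≤ j) (h' : j ≤ D.q) (hc : c ≤ 1) : D.Core (j, c) := by
  have h1 := D.size
  exact (core_iff (by unfold layers; omega)).2 (.inl ⟨hc, not_isCap_of_le h h'⟩)

theorem core_of_isWide {j : ℕ} (h : D.IsWide j) : D.Core (j, 2) := by
  have h1 := D.size; have h2 := D.room
  refine (core_iff ?_).2 (.inr ⟨rfl, .inr h⟩)
  unfold IsWide at h
  unfold layers
  omega

/-- A loop that covers one side of a layer is extended over the next layer `s'`. -/
theorem exists_loop_extend {P : ℕ × ℕ → Prop} {s s' N : ℕ} (hs : 1 ≤ s') (hs' : s' ≤ D.q)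
    (hadj : s ≤ s' + 1) (hadj' : s' ≤ s + 1) (hP : ∀ p, P p → p.1 ≠ s')
    (h : ∀ c c', c ≤ 1 → c' ≤ 1 → c ≠ c' → HasPath layerGraph P (s, c) (s, c') N) (c c' : ℕ)
    (hc : c ≤ 1) (hc' : c' ≤ 1) (hne : c ≠ c') :
    HasPath layerGraph (fun p => P p ∨ (D.Core p ∧ p.1 = s')) (s', c) (s', c')
      (N + D.layerSize s') := by
  have hnP : ∀ c, ¬ P (s', c) := fun c hc => hP _ hc rfl
  by_cases hw : D.IsWide s'
  · have hsz : D.layerSize s' = 3 := by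
      unfold layerSize
      rw [if_neg (not_isCap_of_le hs hs'), if_pos hw]
    rw [hsz]
    refine ((((h c' c hc' hc hne.symm).cons (w := (s', 2))
      ⟨by simp; omega, hadj', hadj⟩ (hnP _)).cons (w := (s', c))
      ⟨by simp; omega, by simp, by simp⟩ ?_).snoc (w := (s', c'))
      ⟨by simpa using hne, hadj, hadj'⟩ ?_).mono ?_
    · rintro (h | h)
      · exact hnP _ h
      · simp at h; omega
    · rintro ((h | h) | h)
      · exact hnP _ h
      · simp at h; omega
      · simp at h; omega
    · rintro p (((h | rfl) | rfl) | rfl)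
      · exact .inl h
      · exact .inr ⟨core_of_isWide hw, rfl⟩
      · exact .inr ⟨core_of_le hs hs' hc, rfl⟩
      · exact .inr ⟨core_of_le hs hs' hc', rfl⟩
  · have hsz : D.layerSize s' = 2 := by
      unfold layerSize
      rw [if_neg (not_isCap_of_le hs hs'), if_neg hw]
    rw [hsz]
    refine (((h c' c hc' hc hne.symm).cons (w := (s', c))
      ⟨by simpa using hne, hadj', hadj⟩ (hnP _)).snoc (w := (s', c'))
      ⟨by simpa using hne, hadj, hadj'⟩ ?_).mono ?_
    · rintro (h | h)
      · exact hnP _ h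
      · simp at h; omega
    · rintro p ((h | rfl) | rfl)
      · exact .inl h
      · exact .inr ⟨core_of_le hs hs' hc, rfl⟩
      · exact .inr ⟨core_of_le hs hs' hc', rfl⟩

/-- The loop through a cap `z` from one vertex of the layer `s` next to it to the other. -/
theorem exists_loop_cap {s z : ℕ} (hs : 1 ≤ s) (hs' : s ≤ D.q) (hw : ¬ D.IsWide s)
    (hz : D.IsCap z) (hz' : z ≤ D.q + 1) (hadj : s ≤ z + 1) (hadj' : z ≤ s + 1) (c c' : ℕ)
    (hc : c ≤ 1) (hc' : c' ≤ 1) (hne : c ≠ c') :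
    HasPath layerGraph (fun p => D.Core p ∧ (p.1 = z ∨ p.1 = s)) (s, c) (s, c')
      (D.layerSize z + D.layerSize s) := by
  have h1 := D.size
  have hsz : D.layerSize s = 2 := by
    unfold layerSize
    rw [if_neg (not_isCap_of_le hs hs'), if_neg hw]
  have hsz' : D.layerSize z = 1 := by
    unfold layerSize
    rw [if_pos hz]
  have hcz : D.Core (z, 2) := (core_iff (by unfold layers; omega)).2 (.inr ⟨rfl, .inl hz⟩)
  rw [hsz, hsz']
  refine (((HasPath.single (G := layerGraph) (P := fun p => p = (z, 2)) rfl).cons (w := (s, c))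
    ⟨by simp; omega, hadj, hadj'⟩ (by simp; omega)).snoc (w := (s, c'))
    ⟨by simp; omega, hadj', hadj⟩ (by simp; omega)).mono ?_
  rintro p ((rfl | rfl) | rfl)
  · exact ⟨hcz, .inl rfl⟩
  · exact ⟨core_of_le hs hs' hc, .inr rfl⟩
  · exact ⟨core_of_le hs hs' hc', .inr rfl⟩

/-- The vertices of the layers up to `s` have a Hamiltonian path that joins the two vertices of
colours `0` and `1` in layer `s`. -/
theorem exists_low_loop (s : ℕ) (hs : 1 ≤ s) (hs' : s ≤ D.q) :
    ∀ c c', c ≤ 1 → c' ≤ 1 → c ≠ c' → HasPath layerGraph (fun p => D.Core p ∧ p.1 ≤ s)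
      (s, c) (s, c') (∑ j ∈ Finset.range (s + 1), D.layerSize j) := by
  induction s, hs using Nat.le_induction with
  | base =>
    intro c c' hc hc' hne
    rw [Finset.sum_range_succ, Finset.sum_range_one]
    refine (exists_loop_cap (z := 0) le_rfl hs' (by unfold IsWide; omega) (.inl rfl) (by omega)
      (by omega) (by omega) c c' hc hc' hne).mono ?_
    exact fun p hp => ⟨hp.1, by omega⟩
  | succ s hs ih =>
    intro c c' hc hc' hne
    rw [Finset.sum_range_succ]
    refine (exists_loop_extend (s := s) (by omega) hs' (by omega) le_rfl
      (fun p hp => by have := hp.2; omega) (ih (by omega)) c c' hc hc' hne).mono ?_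
    rintro p (⟨h, h'⟩ | ⟨h, h'⟩) <;> exact ⟨h, by omega⟩

/-- The vertices of the layers from `s` to `q + 1` have a Hamiltonian path that joins the two
vertices of colours `0` and `1` in layer `s`. -/
theorem exists_high_loop (s : ℕ) (hs : 1 ≤ s) (hs' : s ≤ D.q) :
    ∀ c c', c ≤ 1 → c' ≤ 1 → c ≠ c' →
      HasPath layerGraph (fun p => D.Core p ∧ s ≤ p.1 ∧ p.1 ≤ D.q + 1)
        (s, c) (s, c') (∑ j ∈ Finset.Ico s (D.q + 2), D.layerSize j) := by
  have hroom := D.room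
  induction hs' using Nat.decreasingInduction with
  | self =>
    intro c c' hc hc' hne
    rw [Finset.sum_Ico_succ_top (by omega), Finset.sum_Ico_succ_top (by omega), Finset.Ico_self,
      Finset.sum_empty, zero_add, add_comm (D.layerSize D.q)]
    refine (exists_loop_cap (z := D.q + 1) hs le_rfl (by unfold IsWide; omega) (.inr (.inl rfl))
      (by omega) (by omega) (by omega) c c' hc hc' hne).mono ?_
    exact fun p hp => ⟨hp.1, by omega⟩
  | of_succ s hsq ih =>
    intro c c' hc hc' hne
    rw [Finset.sum_eq_sum_Ico_succ_bot (by omega), add_comm (D.layerSize s)]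
    refine (exists_loop_extend (D := D) (s := s + 1) hs (by omega) (by omega) (by omega)
      (fun p hp => by have := hp.2; omega) (ih (by omega)) c c' hc hc' hne).mono ?_
    rintro p (⟨h, h'⟩ | ⟨h, h'⟩) <;> exact ⟨h, by omega⟩

theorem sum_layerSize : ∑ j ∈ Finset.range (D.q + 2), D.layerSize j + 1 = D.ℓ := by
  have hsize := D.size; have hroom := D.room; have hlo := D.cap_lower
  have e : ∑ j ∈ Finset.range (D.q + 2), D.layerSize j +
      ((Finset.range (D.q + 2)).filter fun j => D.IsCap j).card =
      2 * (D.q + 2) + ((Finset.range (D.q + 2)).filter fun j => D.IsWide j).card := by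
    rw [Finset.card_filter, Finset.card_filter, ← Finset.sum_add_distrib]
    have : 2 * (D.q + 2) = ∑ j ∈ Finset.range (D.q + 2), 2 := by simp; ring
    rw [this, ← Finset.sum_add_distrib]
    refine Finset.sum_congr rfl fun j _ => ?_
    by_cases hc : D.IsCap j
    · have hw : ¬ D.IsWide j := fun hw => D.not_isCap_of_isWide hw hc
      simp [layerSize, hc, hw]
    · by_cases hw : D.IsWide j <;> simp [layerSize, hc, hw]
  have e1 : ((Finset.range (D.q + 2)).filter fun j => D.IsCap j) = {0, D.q + 1} := by
    ext j
    rw [Finset.mem_filter, Finset.mem_range, Finset.mem_insert, Finset.mem_singleton, IsCap]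
    omega
  have e2 : ((Finset.range (D.q + 2)).filter fun j => D.IsWide j) =
      (Finset.range D.κ).image fun i => 6 * (i + 1) := by
    ext j
    rw [Finset.mem_filter, Finset.mem_range, Finset.mem_image, IsWide]
    simp only [Finset.mem_range]
    constructor
    · exact fun h => ⟨j / 6 - 1, by omega, by omega⟩
    · rintro ⟨i, hi, rfl⟩
      omega
  rw [e1, e2, Finset.card_pair (by omega),
    Finset.card_image_of_injective _ (fun a b h => by simpa using h), Finset.card_range] at e
  omega

/-- Given loops that cover the two sides of the wide layer `h`, there are Hamiltonian paths of the
block from `(h, x)` to all vertices in the layers `h`, `s` and `s'` on one side of it. -/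
theorem exists_hamiltonian_of_loops {h t s s' x N₁ N₂ N₃ : ℕ} {P₁ P₂ P₃ R : ℕ × ℕ → Prop}
    (hx : x ≤ 1)
    (loop₁ : ∀ c c', c ≤ 1 → c' ≤ 1 → c ≠ c' → HasPath layerGraph P₁ (t, c) (t, c') N₁)
    (loop₂ : ∀ c c', c ≤ 1 → c' ≤ 1 → c ≠ c' → HasPath layerGraph P₂ (s, c) (s, c') N₂)
    (loop₃ : ∀ c c', c ≤ 1 → c' ≤ 1 → c ≠ c' → HasPath layerGraph P₃ (s', c) (s', c') N₃)
    (ht : t ≤ h + 1) (ht' : h ≤ t + 1) (hs : s ≤ h + 1) (hs' : h ≤ s + 1) (hss : s ≤ s' + 1)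
    (hss' : s' ≤ s + 1) (hsh : s ≠ h) (h₁ : ∀ p, P₁ p → p.1 ≠ h ∧ p.1 ≠ s ∧ ¬ P₂ p ∧ ¬ P₃ p)
    (h₂ : ∀ p, P₂ p → p.1 ≠ h) (h₃ : ∀ p, P₃ p → p.1 ≠ h ∧ p.1 ≠ s)
    (hR₁ : ∀ p, P₁ p → R p) (hR₂ : ∀ p, P₂ p → R p) (hR₃ : ∀ p, P₃ p → R p)
    (hRh : ∀ c ≤ 2, R (h, c)) (hRs : ∀ c ≤ 1, R (s, c)) (hN : N₂ = 2 + N₃) {b c : ℕ}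
    (hw : (b = h ∧ c ≤ 2 ∧ c ≠ x) ∨ (b = s ∧ c ≤ 1) ∨ (b = s' ∧ c ≤ 1)) :
    HasPath layerGraph R (h, x) (b, c) (N₁ + 3 + N₂) := by
  obtain ⟨y, hy, hxy⟩ : ∃ y, y ≤ 1 ∧ x ≠ y := ⟨1 - x, by omega, by omega⟩
  have n₁ : ∀ c, ¬ P₁ (h, c) := fun c hc => (h₁ _ hc).1 rfl
  have n₂ : ∀ c, ¬ P₂ (h, c) := fun c hc => h₂ _ hc rfl
  have n₃ : ∀ c, ¬ P₃ (h, c) := fun c hc => (h₃ _ hc).1 rfl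
  have start := (loop₁ y x hy hx hxy.symm).cons (w := (h, x)) ⟨hxy, ht', ht⟩ (n₁ _)
  -- `start` covers the first side, and all paths below continue it
  rcases hw with ⟨rfl, hc2, hcx⟩ | ⟨rfl, hc⟩ | ⟨rfl, hc⟩
  · -- `(b, c)` and `(b, d)` are the other two vertices of the wide layer: `(b, d)` is passed between
    -- the two loops, and `(b, c)` comes last
    obtain ⟨d, hd2, hdx, hcd⟩ : ∃ d, d ≤ 2 ∧ d ≠ x ∧ c ≠ d := by
      by_cases h : c = 2
      · exact ⟨y, by omega, by omega, by omega⟩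
      · exact ⟨2, by omega, by omega, h⟩
    obtain ⟨z, z', hz, hz', hzz, hzd, hzc⟩ : ∃ z z', z ≤ 1 ∧ z' ≤ 1 ∧ z ≠ z' ∧ d ≠ z ∧ z' ≠ c := by
      by_cases h : c = 2
      · exact ⟨x, y, by omega, by omega, by omega, by omega, by omega⟩
      · exact ⟨y, x, by omega, by omega, by omega, by omega, by omega⟩
    refine (((start.snoc (w := (b, d)) ⟨by simpa using hdx.symm, ht, ht'⟩ ?_).append
      (loop₂ z z' hz hz' hzz) ⟨hzd, hs', hs⟩ ?_).snoc (w := (b, c)) ⟨hzc, hs, hs'⟩ ?_).mono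
        ?_ |>.congr_length (by ring)
    · rintro (h | h)
      · exact n₁ _ h
      · simp at h; omega
    · rintro p ((h | rfl) | rfl)
      · exact (h₁ _ h).2.2.1
      · exact n₂ _
      · exact n₂ _
    · rintro (((h | h) | h) | h)
      · exact n₁ _ h
      · simp at h; omega
      · simp at h; omega
      · exact n₂ _ h
    · rintro p ((((h | rfl) | rfl) | h) | rfl)
      · exact hR₁ _ h
      · exact hRh _ (by omega)
      · exact hRh _ hd2
      · exact hR₂ _ h
      · exact hRh _ hc2
  · refine (((start.snoc (w := (h, y)) ⟨hxy, ht, ht'⟩ ?_).snoc (w := (h, 2))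
      ⟨by simp; omega, by simp, by simp⟩ ?_).append (loop₂ (1 - c) c (by omega) hc (by omega))
      ⟨by simp; omega, hs', hs⟩ ?_).mono ?_ |>.congr_length (by ring)
    · rintro (h | h)
      · exact n₁ _ h
      · simp at h; omega
    · rintro ((h | h) | h)
      · exact n₁ _ h
      · simp at h; omega
      · simp at h; omega
    · rintro p (((h | rfl) | rfl) | rfl)
      · exact (h₁ _ h).2.2.1
      · exact n₂ _
      · exact n₂ _
      · exact n₂ _
    · rintro p ((((h | rfl) | rfl) | rfl) | h)
      · exact hR₁ _ h
      · exact hRh _ (by omega)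
      · exact hRh _ (by omega)
      · exact hRh _ le_rfl
      · exact hR₂ _ h
  · have m₁ : ∀ c, ¬ P₁ (s, c) := fun c hc => (h₁ _ hc).2.1 rfl
    have m₃ : ∀ c, ¬ P₃ (s, c) := fun c hc => (h₃ _ hc).2 rfl
    refine (((((start.snoc (w := (h, y)) ⟨hxy, ht, ht'⟩ ?_).snoc (w := (h, 2))
      ⟨by simp; omega, by simp, by simp⟩ ?_).snoc (w := (s, 1 - c))
      ⟨by simp; omega, hs', hs⟩ ?_).snoc (w := (s, c))
      ⟨by simp; omega, by simp, by simp⟩ ?_).append (loop₃ (1 - c) c (by omega) hc (by omega))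
      ⟨by simp; omega, hss, hss'⟩ ?_).mono ?_ |>.congr_length (by rw [hN]; ring)
    · rintro (h | h)
      · exact n₁ _ h
      · simp at h; omega
    · rintro ((h | h) | h)
      · exact n₁ _ h
      · simp at h; omega
      · simp at h; omega
    · rintro (((h | h) | h) | h)
      · exact m₁ _ h
      · simp at h; omega
      · simp at h; omega
      · simp at h; omega
    · rintro ((((h | h) | h) | h) | h)
      · exact m₁ _ h
      · simp at h; omega
      · simp at h; omega
      · simp at h; omega
      · simp at h; omega
    · rintro p (((((h | rfl) | rfl) | rfl) | rfl) | rfl)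
      · exact (h₁ _ h).2.2.2
      · exact n₃ _
      · exact n₃ _
      · exact n₃ _
      · exact m₃ _
      · exact m₃ _
    · rintro p ((((((h | rfl) | rfl) | rfl) | rfl) | rfl) | h)
      · exact hR₁ _ h
      · exact hRh _ (by omega)
      · exact hRh _ (by omega)
      · exact hRh _ le_rfl
      · exact hRs _ (by omega)
      · exact hRs _ hc
      · exact hR₃ _ h

/-- The first block has Hamiltonian paths from a vertex of colour `0` or `1` in a wide layer to all
vertices in the layers at distance at most two. -/
theorem exists_hamiltonian_path {h x b c : ℕ} (hh : D.IsWide h) (hx : x ≤ 1) (hb : b ≤ h + 2)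
    (hb' : h ≤ b + 2) (hw : D.Core (b, c)) (hne : (b, c) ≠ (h, x)) :
    HasPath layerGraph (fun p => D.Core p ∧ p.1 ≤ D.q + 1) (h, x) (b, c) (D.ℓ - 1) := by
  have hsize := D.size; have hroom := D.room
  have hh' := hh
  unfold IsWide at hh'
  have hL : D.layers = D.ℓ + 1 := rfl
  have hmem := (core_iff (by omega)).1 hw
  have hcap : ¬ D.IsCap b := not_isCap_of_le (by omega) (by omega)
  have hc : (b = h ∧ c ≤ 2 ∧ c ≠ x) ∨ (b ≠ h ∧ c ≤ 1) := by
    by_cases hbh : b = h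
    · subst hbh
      refine .inl ⟨rfl, ?_, fun hcx => hne (by rw [hcx])⟩
      rcases hmem with h | h <;> omega
    · refine .inr ⟨hbh, ?_⟩
      rcases hmem with h | ⟨h, h' | h'⟩
      · exact h.1
      · exact absurd h' hcap
      · unfold IsWide at h'
        omega
  have hRh : ∀ c ≤ 2, D.Core (h, c) ∧ (h, c).1 ≤ D.q + 1 := by
    intro c hc
    refine ⟨?_, by simp; omega⟩
    by_cases h2 : c = 2
    · exact h2 ▸ core_of_isWide hh
    · exact core_of_le (by omega) (by omega) (by omega)
  have hsz : D.layerSize h = 3 := by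
    unfold layerSize
    rw [if_neg (not_isCap_of_le (by omega) (by omega)), if_pos hh]
  have hsz2 : ∀ j, 1 ≤ j → j ≤ D.q → j % 6 ≠ 0 → D.layerSize j = 2 := by
    intro j h1 h2 h3
    unfold layerSize
    rw [if_neg (not_isCap_of_le h1 h2), if_neg (by unfold IsWide; omega)]
  have htotal := sum_layerSize (D := D)
  rw [← Finset.sum_range_add_sum_Ico _ (show h ≤ D.q + 2 by omega),
    Finset.sum_eq_sum_Ico_succ_bot (show h < D.q + 2 by omega), hsz] at htotal
  have hlow := Finset.sum_range_succ D.layerSize (h - 1)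
  have hhigh := Finset.sum_eq_sum_Ico_succ_bot (show h + 1 < D.q + 2 by omega) D.layerSize
  rw [hsz2 _ (by omega) (by omega) (by omega)] at hlow hhigh
  have e1 : h - 1 + 1 = h := by omega
  have e2 : h - 2 + 1 = h - 1 := by omega
  rw [e1] at hlow
  by_cases hbh : h ≤ b
  · refine (exists_hamiltonian_of_loops (t := h - 1) (s := h + 1) (s' := h + 2) hx
      (exists_low_loop (D := D) (h - 1) (by omega) (by omega))
      (exists_high_loop (D := D) (h + 1) (by omega) (by omega))
      (exists_high_loop (D := D) (h + 2) (by omega) (by omega))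
      (by omega) (by omega) (by omega) (by omega) (by omega) (by omega) (by omega)
      (fun p hp => ⟨by have := hp.2; omega, by have := hp.2; omega,
        fun h => by have := hp.2; have := h.2; omega, fun h => by have := hp.2; have := h.2; omega⟩)
      (fun p hp => by have := hp.2; omega)
      (fun p hp => ⟨by have := hp.2; omega, by have := hp.2; omega⟩)
      (fun p hp => ⟨hp.1, by have := hp.2; omega⟩) (fun p hp => ⟨hp.1, by have := hp.2; omega⟩)
      (fun p hp => ⟨hp.1, by have := hp.2; omega⟩) hRh
      (fun c hc => ⟨core_of_le (by omega) (by omega) hc, by simp; omega⟩) hhigh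
      (by omega)).congr_length ?_
    rw [e1]
    omega
  · refine (exists_hamiltonian_of_loops (t := h + 1) (s := h - 1) (s' := h - 2) hx
      (exists_high_loop (D := D) (h + 1) (by omega) (by omega))
      (exists_low_loop (D := D) (h - 1) (by omega) (by omega))
      (exists_low_loop (D := D) (h - 2) (by omega) (by omega))
      (by omega) (by omega) (by omega) (by omega) (by omega) (by omega) (by omega)
      (fun p hp => ⟨by have := hp.2; omega, by have := hp.2; omega,
        fun h => by have := hp.2; have := h.2; omega, fun h => by have := hp.2; have := h.2; omega⟩)
      (fun p hp => by have := hp.2; omega)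
      (fun p hp => ⟨by have := hp.2; omega, by have := hp.2; omega⟩)
      (fun p hp => ⟨hp.1, by have := hp.2; omega⟩) (fun p hp => ⟨hp.1, by have := hp.2; omega⟩)
      (fun p hp => ⟨hp.1, by have := hp.2; omega⟩) hRh
      (fun c hc => ⟨core_of_le (by omega) (by omega) hc, by simp; omega⟩)
      (by rw [e1, e2, hlow]; omega) (by omega)).congr_length ?_
    rw [e1]
    omega

end RingParams

/-! ### The ring has no cycle on `ℓ` vertices -/

theorem exists_eq_of_lt_of_gt {s : ℕ → ℕ} (hs : ∀ i, s i ≤ s (i + 1) + 1) {P a : ℕ} (ha : P < s a)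
    (d : ℕ) (hd : s (a + d) < P) : ∃ i, a < i ∧ i < a + d ∧ s i = P := by
  induction d with
  | zero => exact absurd (ha.trans hd) (lt_irrefl _)
  | succ d ih =>
    have h := hs (a + d)
    rw [Nat.add_assoc] at h
    rcases lt_trichotomy (s (a + d)) P with h' | h' | h'
    · obtain ⟨i, h1, h2, h3⟩ := ih h'
      exact ⟨i, h1, by omega, h3⟩
    · refine ⟨a + d, ?_, by omega, h'⟩
      rcases Nat.eq_zero_or_pos d with rfl | h0
      · rw [Nat.add_zero] at h'; omega
      · omega
    · omega

theorem exists_eq_of_gt_of_lt {s : ℕ → ℕ} (hs : ∀ i, s (i + 1) ≤ s i + 1) {P a : ℕ} (ha : s a < P)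
    (d : ℕ) (hd : P < s (a + d)) : ∃ i, a < i ∧ i < a + d ∧ s i = P := by
  induction d with
  | zero => exact absurd (ha.trans hd) (lt_irrefl _)
  | succ d ih =>
    have h := hs (a + d)
    rw [Nat.add_assoc] at h
    rcases lt_trichotomy (s (a + d)) P with h' | h' | h'
    · omega
    · refine ⟨a + d, ?_, by omega, h'⟩
      rcases Nat.eq_zero_or_pos d with rfl | h0
      · rw [Nat.add_zero] at h'; omega
      · omega
    · obtain ⟨i, h1, h2, h3⟩ := ih h'
      exact ⟨i, h1, by omega, h3⟩

namespace RingParams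

variable {D : RingParams}

variable (D) in
/-- Layers of the ring that are equal or cyclically consecutive. -/
def Near (a b : ℕ) : Prop := a = b ∨ b = (a + 1) % D.layers ∨ a = (b + 1) % D.layers

theorem Near.symm {a b : ℕ} (h : D.Near a b) : D.Near b a := by
  rcases h with h | h | h
  · exact .inl h.symm
  · exact .inr (.inr h)
  · exact .inr (.inl h)

theorem add_one_mod_layers {a : ℕ} (ha : a < D.layers) :
    (a + 1) % D.layers = if a + 1 = D.layers then 0 else a + 1 := by
  split
  · next h => rw [h, Nat.mod_self]
  · exact Nat.mod_eq_of_lt (by omega)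

theorem near_iff {a b : ℕ} (ha : a < D.layers) (hb : b < D.layers) :
    D.Near a b ↔ (a ≤ b + 1 ∧ b ≤ a + 1) ∨ (a = 0 ∧ b + 1 = D.layers) ∨
      (b = 0 ∧ a + 1 = D.layers) := by
  unfold Near
  rw [add_one_mod_layers ha, add_one_mod_layers hb]
  split <;> split <;> omega

/-- The number of vertices in the layers from the cap `a` to the cap `b` with no wide layer in
between. -/
theorem le_of_forall_mem_narrow {g : ℕ → ℕ × ℕ} (hmem : ∀ i, D.Mem (g i).1 (g i).2)
    (hinj : ∀ i < D.ℓ, ∀ j < D.ℓ, g i = g j → i = j) {a b c : ℕ} (ha : D.q < a) (hab : a < b)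
    (hg : ∀ i, (a ≤ (g i).1 ∧ (g i).1 < b) ∨ (g i).1 = c) (hca : D.IsCap a) (hc : D.IsCap c)
    (hno : ∀ j, a < j → j < b → ¬ D.IsCap j) :
    D.ℓ ≤ 2 * (b - a) := by
  have hroom := D.room
  have key := Finset.card_le_card_of_injOn (s := Finset.range D.ℓ)
    (t := Finset.Ioo a b ×ˢ Finset.range 2 ∪ {(a, 2), (c, 2)}) g ?_ ?_
  · have h2 : (Finset.Ioo a b ×ˢ Finset.range 2 ∪ {(a, 2), (c, 2)}).card ≤
        (b - a - 1) * 2 + 2 := by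
      refine (Finset.card_union_le _ _).trans (Nat.add_le_add ?_ Finset.card_le_two)
      rw [Finset.card_product, Nat.card_Ioo, Finset.card_range]
    rw [Finset.card_range] at key
    omega
  · intro i _
    rw [Finset.mem_coe]
    have hi := hmem i
    have hi' := hg i
    have hwide : ¬ D.IsWide (g i).1 ∨ (g i).1 = c := by unfold IsWide; omega
    have hcap : ∀ j, D.IsCap j → D.Mem j (g i).2 → (g i).2 = 2 := fun j hj h => by
      rcases h with h | h
      · exact absurd hj h.2
      · exact h.1
    generalize g i = p at hi hi' hwide hcap ⊢
    obtain ⟨j, y⟩ := p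
    dsimp only at hi hi' hwide hcap
    simp only [Finset.mem_union, Finset.mem_product, Finset.mem_Ioo, Finset.mem_range,
      Finset.mem_insert, Finset.mem_singleton, Prod.mk.injEq]
    by_cases h1 : j = c
    · exact .inr (.inr ⟨h1, hcap c hc (h1 ▸ hi)⟩)
    · by_cases h2 : j = a
      · exact .inr (.inl ⟨h2, hcap a hca (h2 ▸ hi)⟩)
      · have h3 : a < j ∧ j < b := by omega
        have h4 := hno j h3.1 h3.2
        left
        rcases hi with hi | ⟨-, h | h⟩
        · omega
        · exact absurd h h4
        · exact absurd h (hwide.resolve_right h1)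
  · intro i hi j hj h
    exact hinj i (by simpa using hi) j (by simpa using hj) h

/-- The layers from `0` to `q + 1` have fewer than `ℓ` vertices. -/
theorem not_forall_mem_first_block {g : ℕ → ℕ × ℕ} (hmem : ∀ i, D.Mem (g i).1 (g i).2)
    (hinj : ∀ i < D.ℓ, ∀ j < D.ℓ, g i = g j → i = j) : ¬ ∀ i, (g i).1 ≤ D.q + 1 := by
  intro hg
  have hroom := D.room; have hsize := D.size; have hlo := D.cap_lower
  have key := Finset.card_le_card_of_injOn (s := Finset.range D.ℓ)
    (t := Finset.Icc 1 D.q ×ˢ Finset.range 2 ∪ {(0, 2), (D.q + 1, 2)} ∪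
      (Finset.range D.κ).image fun i => (6 * (i + 1), 2)) g ?_ ?_
  · have h2 : (Finset.Icc 1 D.q ×ˢ Finset.range 2 ∪ {(0, 2), (D.q + 1, 2)} ∪
        (Finset.range D.κ).image fun i => (6 * (i + 1), 2)).card ≤ D.q * 2 + 2 + D.κ := by
      refine (Finset.card_union_le _ _).trans (Nat.add_le_add ?_ ?_)
      · refine (Finset.card_union_le _ _).trans (Nat.add_le_add ?_ Finset.card_le_two)
        rw [Finset.card_product, Nat.card_Icc, Finset.card_range, Nat.add_sub_cancel]
      · exact Finset.card_image_le.trans (by rw [Finset.card_range])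
    rw [Finset.card_range] at key
    omega
  · intro i _
    rw [Finset.mem_coe]
    have hi := hmem i
    have hi' := hg i
    generalize g i = p at hi hi' ⊢
    obtain ⟨j, y⟩ := p
    dsimp only at hi hi'
    simp only [Finset.mem_union, Finset.mem_product, Finset.mem_Icc, Finset.mem_range,
      Finset.mem_insert, Finset.mem_singleton, Prod.mk.injEq, Finset.mem_image]
    rcases hi with ⟨hy, hc⟩ | ⟨hy, hc | hc⟩
    · refine .inl (.inl ?_)
      unfold IsCap at hc
      omega
    · refine .inl (.inr ?_)
      unfold IsCap at hc
      omega
    · refine .inr ⟨j / 6 - 1, ?_⟩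
      unfold IsWide at hc
      omega
  · intro i hi j hj h
    exact hinj i (by simpa using hi) j (by simpa using hj) h

/-- The ring has no cycle on `ℓ` vertices. Such a cycle misses one of the `ℓ + 1` layers; if the
ring is cut open there, the caps are cut vertices, so the cycle lies between consecutive caps, where
there is not enough room. -/
theorem false_of_cycle {g : ℕ → ℕ × ℕ} (hlt : ∀ i, (g i).1 < D.layers)
    (hmem : ∀ i, D.Mem (g i).1 (g i).2) (hnear : ∀ i, D.Near (g i).1 (g (i + 1)).1)
    (hper : ∀ i, g (i + D.ℓ) = g i) (hinj : ∀ i j, g i = g j → i % D.ℓ = j % D.ℓ) : False := by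
  have hroom := D.room; have hsize := D.size; have hlo := D.cap_lower; have hup := D.cap_upper
  have hκ := D.two_le
  have hL : D.layers = D.ℓ + 1 := rfl
  have hinj' : ∀ i < D.ℓ, ∀ j < D.ℓ, g i = g j → i = j := fun i hi j hj h => by
    have := hinj i j h
    rwa [Nat.mod_eq_of_lt hi, Nat.mod_eq_of_lt hj] at this
  have hmod : ∀ i, g (i % D.ℓ) = g i := by
    have : ∀ t i, g (i + D.ℓ * t) = g i := by
      intro t
      induction t with
      | zero => simp
      | succ t ih => intro i; rw [Nat.mul_succ, ← Nat.add_assoc, hper, ih]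
    intro i
    conv_rhs => rw [← Nat.mod_add_div i D.ℓ, this]
  -- a layer that the cycle misses
  obtain ⟨m, hm, hmiss⟩ : ∃ m < D.layers, ∀ i, (g i).1 ≠ m := by
    by_contra! hcon
    have h : Finset.range D.layers ⊆ (Finset.range D.ℓ).image fun i => (g i).1 := by
      intro m hm
      obtain ⟨i, hi⟩ := hcon m (Finset.mem_range.1 hm)
      exact Finset.mem_image.2 ⟨i % D.ℓ, Finset.mem_range.2 (Nat.mod_lt _ (by omega)), by
        rw [hmod, hi]⟩
    have := (Finset.card_le_card h).trans Finset.card_image_le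
    rw [Finset.card_range, Finset.card_range] at this
    omega
  -- positions along the ring, cut open at layer `m`
  let s : ℕ → ℕ := fun i => if m < (g i).1 then (g i).1 else (g i).1 + D.layers
  have hs : ∀ i, (m < (g i).1 ∧ s i = (g i).1) ∨ ((g i).1 < m ∧ s i = (g i).1 + D.layers) := by
    intro i
    have := hmiss i
    by_cases h : m < (g i).1
    · exact .inl ⟨h, if_pos h⟩
    · exact .inr ⟨by omega, if_neg h⟩
  have hper' : ∀ i, s (i + D.ℓ) = s i := fun i => by simp only [s, hper]
  have hstep : ∀ i, s i ≤ s (i + 1) + 1 ∧ s (i + 1) ≤ s i + 1 := by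
    intro i
    have h1 := hs i
    have h2 := hs (i + 1)
    have h3 := (near_iff (hlt i) (hlt (i + 1))).1 (hnear i)
    have h4 := hlt i
    have h5 := hlt (i + 1)
    omega
  have hsep : ∀ P z, D.IsCap z → (P = z ∨ P = z + D.layers) → (∀ i, s i ≤ P) ∨ ∀ i, P ≤ s i := by
    intro P z hz hP
    by_contra! hcon
    obtain ⟨⟨a, ha⟩, ⟨b, hb⟩⟩ := hcon
    -- a representative of `b` modulo `ℓ` between `a` and `a + ℓ`
    obtain ⟨d, hd, hdb⟩ : ∃ d < D.ℓ, s (a + d) = s b := by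
      refine ⟨(b + (D.ℓ - a % D.ℓ)) % D.ℓ, Nat.mod_lt _ (by omega), ?_⟩
      have h : g (a + (b + (D.ℓ - a % D.ℓ)) % D.ℓ) = g b := by
        rw [← hmod, ← hmod b]
        congr 1
        have h1 := Nat.mod_lt a (show 0 < D.ℓ by omega)
        rw [Nat.add_mod_mod]
        conv_lhs => rw [← Nat.mod_add_div a D.ℓ]
        have e : a % D.ℓ + D.ℓ * (a / D.ℓ) + (b + (D.ℓ - (a % D.ℓ + D.ℓ * (a / D.ℓ)) % D.ℓ)) =
            b + D.ℓ * (a / D.ℓ + 1) := by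
          rw [Nat.mod_add_div]
          have := Nat.mod_add_div a D.ℓ
          rw [Nat.mul_add]
          omega
        rw [e, Nat.add_mul_mod_self_left]
      simp only [s, h]
    have hd0 : 0 < d := by
      rcases Nat.eq_zero_or_pos d with rfl | h
      · rw [Nat.add_zero] at hdb; omega
      · exact h
    obtain ⟨i, hi1, hi2, hi3⟩ := exists_eq_of_lt_of_gt (fun i => (hstep i).1) ha d (by omega)
    obtain ⟨j, hj1, hj2, hj3⟩ := exists_eq_of_gt_of_lt (P := P) (fun i => (hstep i).2)
      (show s (a + d) < P by omega) (D.ℓ - d) (by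
        rw [show a + d + (D.ℓ - d) = a + D.ℓ by omega, hper']; exact ha)
    have huniq : ∀ i, s i = P → g i = (z, 2) := by
      intro i hi
      have h1 := hs i
      have h2 := hlt i
      have h3 : z < D.layers := by unfold IsCap at hz; omega
      have h4 : (g i).1 = z := by omega
      have h5 := hmem i
      rw [h4] at h5
      refine Prod.ext h4 ?_
      rcases h5 with h5 | h5
      · exact absurd hz h5.2
      · exact h5.1
    have hmodeq : j % D.ℓ = i % D.ℓ := hinj j i ((huniq j hj3).trans (huniq i hi3).symm)
    have hdvd : D.ℓ ∣ j - i := (Nat.modEq_iff_dvd' (by omega)).1 hmodeq.symm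
    have := Nat.le_of_dvd (by omega) hdvd
    omega
  have first := not_forall_mem_first_block hmem hinj'
  have second : ¬ ∀ i, D.q + 1 ≤ (g i).1 ∧ (g i).1 ≤ D.C := fun h => by
    have := le_of_forall_mem_narrow (b := D.C) (c := D.C) hmem hinj' (Nat.lt_succ_self _)
      (by omega) (fun i => by have := h i; omega) (.inr (.inl rfl)) (.inr (.inr rfl))
      (fun j h1 h2 => by unfold IsCap; omega)
    omega
  have third : ¬ ∀ i, D.C ≤ (g i).1 ∨ (g i).1 = 0 := fun h => by
    have := le_of_forall_mem_narrow (a := D.C) (b := D.layers) (c := 0) hmem hinj' (by omega)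
      (by omega) (fun i => by have := h i; have := hlt i; omega) (.inr (.inr rfl)) (.inl rfl)
      (fun j h1 h2 => by unfold IsCap; omega)
    omega
  have c₁ := hsep (D.q + 1) (D.q + 1) (.inr (.inl rfl)) (.inl rfl)
  have c₂ := hsep D.C D.C (.inr (.inr rfl)) (.inl rfl)
  have c₃ := hsep D.layers 0 (.inl rfl) (.inr (by omega))
  have c₄ := hsep (D.q + 1 + D.layers) (D.q + 1) (.inr (.inl rfl)) (.inr rfl)
  have c₅ := hsep (D.C + D.layers) D.C (.inr (.inr rfl)) (.inr rfl)
  rcases c₁ with c₁ | c₁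
  · exact first fun i => by have := c₁ i; have := hs i; omega
  rcases c₂ with c₂ | c₂
  · exact second fun i => by have := c₁ i; have := c₂ i; have := hs i; omega
  rcases c₃ with c₃ | c₃
  · exact third fun i => by have := c₂ i; have := c₃ i; have := hs i; omega
  rcases c₄ with c₄ | c₄
  · exact first fun i => by have := c₃ i; have := c₄ i; have := hs i; have := hlt i; omega
  rcases c₅ with c₅ | c₅
  · exact second fun i => by
      have := c₄ i; have := c₅ i; have := hs i; have := hlt i; omega
  · exact third fun i => by have := c₅ i; have := hs i; have := hlt i; omega

end RingParams

/-! ### The saturated graph -/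

namespace RingParams

variable (D : RingParams) {k n : ℕ}

/-- The vertices of the multipartite graph that belong to the ring: the part of a vertex is its
colour, and its index in the part is its layer. -/
def OnRing (v : Fin k × Fin n) : Prop := v.2.val < D.layers ∧ D.Mem v.2 v.1

variable {D} in
theorem OnRing.core {v : Fin k × Fin n} (h : D.OnRing v) : D.Core (v.2, v.1) :=
  (core_iff h.1).2 h.2

/-- The layer and the colour of the vertex of the ring to which the vertices of part `i` outside
of the ring are attached as leaves. -/
def hub (i : ℕ) : ℕ × ℕ := (6 * (i + 1), if i = 1 then 0 else 1)

theorem hub_snd_le (i : ℕ) : (hub i).2 ≤ 1 := by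
  unfold hub
  split <;> simp

theorem hub_snd_ne (i : ℕ) : (hub i).2 ≠ i := by
  unfold hub
  split <;> simp <;> omega

variable [NeZero k] [NeZero n]

/-- The covering map from layers and colours to the vertices of the multipartite graph. -/
def emb (k n : ℕ) [NeZero k] [NeZero n] (p : ℕ × ℕ) : Fin k × Fin n :=
  (Fin.ofNat k p.2, Fin.ofNat n (p.1 % D.layers))

/-- The ring with a leaf attached to the hub of part `i` for each vertex of part `i` outside of the
ring. -/
def ringGraph (k n : ℕ) [NeZero k] [NeZero n] : SimpleGraph (Fin k × Fin n) :=
  SimpleGraph.fromRel fun v w =>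
    (D.OnRing v ∧ D.OnRing w ∧ v.1 ≠ w.1 ∧ D.Near v.2 w.2) ∨
      (¬ D.OnRing v ∧ w = D.emb k n (hub v.1))

variable {D}

theorem snd_le_two {p : ℕ × ℕ} (h : D.Core p) : p.2 ≤ 2 := by
  rcases h with h | h
  · exact h.1.trans (by simp)
  · exact h.1.le

theorem mod_lt_layers (j : ℕ) : j % D.layers < D.layers := Nat.mod_lt _ (Nat.succ_pos _)

theorem emb_fst_val (hk : 3 ≤ k) {p : ℕ × ℕ} (h : p.2 ≤ 2) : ((D.emb k n p).1 : ℕ) = p.2 :=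
  Nat.mod_eq_of_lt (by omega)

theorem emb_snd_val (hn : D.layers ≤ n) (p : ℕ × ℕ) :
    ((D.emb k n p).2 : ℕ) = p.1 % D.layers :=
  Nat.mod_eq_of_lt ((mod_lt_layers p.1).trans_le hn)

theorem onRing_emb (hk : 3 ≤ k) (hn : D.layers ≤ n) {p : ℕ × ℕ} (h : D.Core p) :
    D.OnRing (D.emb k n p) := by
  unfold OnRing
  rw [emb_fst_val hk (snd_le_two h), emb_snd_val hn]
  exact ⟨mod_lt_layers _, h⟩

theorem emb_eq {v : Fin k × Fin n} {j : ℕ} (hj : j % D.layers = v.2) : D.emb k n (j, v.1) = v := by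
  refine Prod.ext (Fin.ext ?_) (Fin.ext ?_)
  · exact Nat.mod_eq_of_lt v.1.2
  · change j % D.layers % n = v.2
    rw [hj]
    exact Nat.mod_eq_of_lt v.2.2

theorem isWide_hub {i : ℕ} (hi : i < D.κ) : D.IsWide (hub i).1 := by
  unfold IsWide hub
  omega

theorem core_hub {i : ℕ} (hi : i < D.κ) : D.Core (hub i) := by
  have hroom := D.room
  exact core_of_le (j := (hub i).1) (by unfold hub; omega) (by unfold hub; omega) (hub_snd_le i)

theorem hub_fst_lt_layers {i : ℕ} (hi : i < D.κ) : (hub i).1 < D.layers := by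
  have hroom := D.room; have hsize := D.size
  unfold hub layers
  omega

theorem ringGraph_adj_of_near {v w : Fin k × Fin n} (hv : D.OnRing v) (hw : D.OnRing w)
    (hne : v.1 ≠ w.1) (h : D.Near v.2 w.2) : (D.ringGraph k n).Adj v w :=
  (SimpleGraph.fromRel_adj _ _ _).2
    ⟨fun e => hne (congrArg Prod.fst e), .inl (.inl ⟨hv, hw, hne, h⟩)⟩

theorem ringGraph_adj_hub (hk : 3 ≤ k) (hκ : k ≤ D.κ) (hn : D.layers ≤ n) {v : Fin k × Fin n}
    (hv : ¬ D.OnRing v) : (D.ringGraph k n).Adj v (D.emb k n (hub v.1)) :=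
  (SimpleGraph.fromRel_adj _ _ _).2
    ⟨fun e => hv (e ▸ onRing_emb hk hn (core_hub (v.1.2.trans_le hκ))), .inl (.inr ⟨hv, rfl⟩)⟩

theorem ringGraph_adj_cases {v w : Fin k × Fin n} (h : (D.ringGraph k n).Adj v w) :
    (D.OnRing v ∧ D.OnRing w ∧ v.1 ≠ w.1 ∧ D.Near v.2 w.2) ∨
      (¬ D.OnRing v ∧ w = D.emb k n (hub v.1)) ∨ (¬ D.OnRing w ∧ v = D.emb k n (hub w.1)) := by
  rcases ((SimpleGraph.fromRel_adj _ _ _).1 h).2 with (h | h) | (⟨h1, h2, h3, h4⟩ | h)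
  · exact .inl h
  · exact .inr (.inl h)
  · exact .inl ⟨h2, h1, h3.symm, h4.symm⟩
  · exact .inr (.inr h)

theorem ringGraph_le (hk : 3 ≤ k) :
    D.ringGraph k n ≤ SimpleGraph.completeEquipartiteGraph k n := by
  have hub_ne : ∀ i : Fin k, i ≠ (D.emb k n (hub i)).1 := fun i h => by
    have h' := congrArg Fin.val h
    rw [emb_fst_val hk ((hub_snd_le i).trans (by simp))] at h'
    exact hub_snd_ne i h'.symm
  intro v w h
  rw [SimpleGraph.completeEquipartiteGraph_adj]
  rcases ringGraph_adj_cases h with h | ⟨-, rfl⟩ | ⟨-, rfl⟩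
  · exact h.2.2.1
  · exact hub_ne v.1
  · exact (hub_ne w.1).symm

theorem ringGraph_free (hk : 3 ≤ k) (hκ : k ≤ D.κ) (hn : D.layers ≤ n) :
    (SimpleGraph.cycleGraph D.ℓ).Free (D.ringGraph k n) := by
  intro hcon
  have hsize := D.size
  obtain ⟨g, hadj, hper, hinj⟩ := exists_periodic_of_cycleGraph_isContained (by omega) hcon
  -- a cycle has no leaves
  have hring : ∀ i, D.OnRing (g (i + 1)) := by
    intro i
    by_contra hi
    have key : ∀ v, (D.ringGraph k n).Adj (g (i + 1)) v → v = D.emb k n (hub (g (i + 1)).1) := by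
      intro v hv
      rcases ringGraph_adj_cases hv with h | h | h
      · exact absurd h.1 hi
      · exact h.2
      · exact absurd (h.2 ▸ onRing_emb hk hn (core_hub (v.1.2.trans_le hκ))) hi
    have h := hinj i (i + 2) ((key _ (hadj i).symm).trans (key _ (hadj (i + 1))).symm)
    have h' := (Nat.modEq_iff_dvd' (show i ≤ i + 2 by omega)).1 h
    have := Nat.le_of_dvd (by omega) h'
    omega
  have hring' : ∀ i, D.OnRing (g i) := by
    intro i
    have := hring (i + D.ℓ - 1)
    rwa [show i + D.ℓ - 1 + 1 = i + D.ℓ by omega, hper] at this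
  refine false_of_cycle (D := D) (g := fun i => ((g i).2, (g i).1)) (fun i => (hring' i).1)
    (fun i => (hring' i).2) (fun i => ?_) (fun i => by simp only [hper]) (fun i j h => hinj i j ?_)
  · rcases ringGraph_adj_cases (hadj i) with h | h | h
    · exact h.2.2.2
    · exact absurd (hring' i) h.1
    · exact absurd (hring' (i + 1)) h.1
  · simp only [Prod.mk.injEq] at h
    exact Prod.ext (Fin.ext h.2) (Fin.ext h.1)

/-- Paths of the cover that stay within one turn project to paths of the ring. -/
theorem hasPath_emb (hk : 3 ≤ k) (hn : D.layers ≤ n) {P : ℕ × ℕ → Prop} {p p' : ℕ × ℕ} {m : ℕ}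
    (j : ℕ) (h : HasPath layerGraph P p p' m)
    (hP : ∀ p, P p → D.Core p ∧ j ≤ p.1 ∧ p.1 < j + D.layers) :
    HasPath (D.ringGraph k n) D.OnRing (D.emb k n p) (D.emb k n p') m := by
  refine h.map (D.emb k n) (fun a b ha hb hab => ?_) (fun a b ha hb hab => ?_)
    fun a ha => onRing_emb hk hn (hP a ha).1
  · have ha' := hP a ha
    have hb' := hP b hb
    refine ringGraph_adj_of_near (onRing_emb hk hn ha'.1) (onRing_emb hk hn hb'.1) (fun e => ?_) ?_
    · have := congrArg Fin.val e
      rw [emb_fst_val hk (snd_le_two ha'.1), emb_fst_val hk (snd_le_two hb'.1)] at this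
      exact hab.1 this
    · rw [emb_snd_val hn, emb_snd_val hn]
      obtain ⟨-, h1, h2⟩ := hab
      unfold Near
      rw [Nat.mod_add_mod, Nat.mod_add_mod]
      obtain e | e | e : a.1 = b.1 ∨ b.1 = a.1 + 1 ∨ a.1 = b.1 + 1 := by omega
      · exact .inl (by rw [e])
      · exact .inr (.inl (by rw [e]))
      · exact .inr (.inr (by rw [e]))
  · have ha' := hP a ha
    have hb' := hP b hb
    have h1 := congrArg (fun v => (v.1 : ℕ)) hab
    have h2 := congrArg (fun v => (v.2 : ℕ)) hab
    simp only [emb_fst_val hk (snd_le_two ha'.1), emb_fst_val hk (snd_le_two hb'.1)] at h1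
    simp only [emb_snd_val hn] at h2
    obtain ⟨i, hi⟩ := Nat.exists_eq_add_of_le ha'.2.1
    obtain ⟨i', hi'⟩ := Nat.exists_eq_add_of_le hb'.2.1
    rw [hi, hi'] at h2
    have := eq_of_add_mod_layers h2 (by omega) (by omega)
    exact Prod.ext (by omega) h1

/-- Two vertices of the ring whose layers have distance at least `r` are joined by paths that go the
long way around. -/
theorem hasPath_of_far (hk : 3 ≤ k) (hn : D.layers ≤ n) {u v : Fin k × Fin n} (hu : D.OnRing u)
    (hv : D.OnRing v) {r m : ℕ} (huv : (u.2 : ℕ) + r ≤ v.2)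
    (hvu : (v.2 : ℕ) + r ≤ u.2 + D.layers) (hm : D.layers + 1 ≤ m + r) (hm' : m + 1 ≤ D.layers) :
    HasPath (D.ringGraph k n) D.OnRing u v m := by
  have hcu := hu.core
  have hcv := hv.core
  have hu' := Nat.mod_eq_of_lt hu.1
  have hv' := Nat.mod_eq_of_lt hv.1
  by_cases hlong : D.layers ≤ 2 * ((v.2 : ℕ) - u.2)
  · have e : (v.2 : ℕ) = u.2 + (v.2 - u.2) := by omega
    have h := exists_path_around (D := D) (j := u.2) (c := u.1) (m := v.2 - u.2) (c' := v.1)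
      (n := m) hcu (e ▸ hcv) hlong (by omega) (by omega) (by omega)
    have h' := hasPath_emb hk hn u.2 h fun p hp => ⟨hp.1, hp.2.1, by have := hp.2.2; omega⟩
    rwa [← e, emb_eq hu', emb_eq hv'] at h'
  · have e : (u.2 : ℕ) + D.layers = v.2 + (u.2 + D.layers - v.2) := by omega
    have emod : ((u.2 : ℕ) + D.layers) % D.layers = u.2 := by rw [Nat.add_mod_right, hu']
    have hcu' : D.Core ((u.2 : ℕ) + D.layers, (u.1 : ℕ)) := by
      unfold Core
      rw [emod]
      exact hu.2
    have h := exists_path_around (D := D) (j := v.2) (c := v.1) (m := u.2 + D.layers - v.2)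
      (c' := u.1) (n := m) hcv (e ▸ hcu') (by omega) (by omega) (by omega) (by omega)
    have h' := hasPath_emb hk hn v.2 h fun p hp => ⟨hp.1, hp.2.1, by have := hp.2.2; omega⟩
    rw [← e, emb_eq emod, emb_eq hv'] at h'
    exact h'.reverse

/-- Every hub is joined to every other vertex of the ring by a path with `ℓ - 1` vertices. If the other
vertex is closer than three layers, the long way around is too long, and the path is a Hamiltonian
path of the first block. -/
theorem hasPath_hub (hk : 3 ≤ k) (hn : D.layers ≤ n) {i : ℕ} (hi : i < D.κ) {v : Fin k × Fin n}
    (hv : D.OnRing v) (hne : v ≠ D.emb k n (hub i)) :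
    HasPath (D.ringGraph k n) D.OnRing (D.emb k n (hub i)) v (D.ℓ - 1) := by
  have hroom := D.room; have hsize := D.size
  have hL : D.layers = D.ℓ + 1 := rfl
  have hu := onRing_emb (k := k) (n := n) hk hn (core_hub hi)
  have hval := emb_snd_val (k := k) hn (hub i)
  rw [Nat.mod_eq_of_lt (hub_fst_lt_layers hi)] at hval
  have hfst : (hub i).1 = 6 * (i + 1) := rfl
  have hlt := hv.1
  by_cases h1 : (hub i).1 + 3 ≤ v.2
  · exact hasPath_of_far hk hn hu hv (r := 3) (by omega) (by omega) (by omega) (by omega)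
  · by_cases h2 : (v.2 : ℕ) + 3 ≤ (hub i).1
    · exact (hasPath_of_far hk hn hv hu (r := 3) (by omega) (by omega) (by omega)
        (by omega)).reverse
    · have hv' := emb_eq (Nat.mod_eq_of_lt hv.1)
      have h := exists_hamiltonian_path (b := v.2) (c := v.1) (isWide_hub hi) (hub_snd_le i)
        (by omega) (by omega) hv.core (fun e => hne (by
          change ((v.2 : ℕ), (v.1 : ℕ)) = hub i at e
          rw [← e, hv']))
      have h' := hasPath_emb hk hn 0 h fun p hp => ⟨hp.1, Nat.zero_le _, by have := hp.2; omega⟩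
      rwa [hv'] at h'

theorem hasPath_hub_hub (hk : 3 ≤ k) (hn : D.layers ≤ n) {i j : ℕ} (hi : i < D.κ) (hj : j < D.κ)
    (hij : i ≠ j) :
    HasPath (D.ringGraph k n) D.OnRing (D.emb k n (hub i)) (D.emb k n (hub j)) (D.ℓ - 2) := by
  have hroom := D.room; have hsize := D.size
  have hL : D.layers = D.ℓ + 1 := rfl
  have key : ∀ i j, i < D.κ → j < D.κ → i < j →
      HasPath (D.ringGraph k n) D.OnRing (D.emb k n (hub i)) (D.emb k n (hub j)) (D.ℓ - 2) := by
    intro i j hi hj hij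
    have hval : ∀ i, i < D.κ → ((D.emb k n (hub i)).2 : ℕ) = 6 * (i + 1) := fun i hi => by
      rw [emb_snd_val (k := k) hn (hub i), Nat.mod_eq_of_lt (hub_fst_lt_layers hi)]
      rfl
    have h1 := hval i hi
    have h2 := hval j hj
    exact hasPath_of_far hk hn (onRing_emb hk hn (core_hub hi)) (onRing_emb hk hn (core_hub hj))
      (r := 4) (by omega) (by omega) (by omega) (by omega)
  rcases lt_or_gt_of_ne hij with h | h
  · exact key i j hi hj h
  · exact (key j i hj hi h).reverse

theorem hasPath_of_not_adj (hk : 3 ≤ k) (hκ : k ≤ D.κ) (hn : D.layers ≤ n) {u v : Fin k × Fin n}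
    (hne : u.1 ≠ v.1) (huv : ¬ (D.ringGraph k n).Adj u v) :
    ∃ P, HasPath (D.ringGraph k n) P u v D.ℓ := by
  have hsize := D.size
  have hL : D.layers = D.ℓ + 1 := rfl
  have leaf : ∀ u v : Fin k × Fin n, ¬ D.OnRing u → D.OnRing v →
      ¬ (D.ringGraph k n).Adj u v → ∃ P, HasPath (D.ringGraph k n) P u v D.ℓ := by
    intro u v hu hv huv
    have hadj := ringGraph_adj_hub hk hκ hn hu
    exact ⟨_, ((hasPath_hub hk hn (u.1.2.trans_le hκ) hv (fun e => huv (e ▸ hadj))).cons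
      hadj hu).congr_length (by omega)⟩
  by_cases hu : D.OnRing u <;> by_cases hv : D.OnRing v
  · have hnear : ¬ D.Near u.2 v.2 := fun h => huv (ringGraph_adj_of_near hu hv hne h)
    rw [near_iff hu.1 hv.1] at hnear
    have h1 := hu.1
    have h2 := hv.1
    rcases le_total (u.2 : ℕ) v.2 with h | h
    · exact ⟨_, hasPath_of_far hk hn hu hv (r := 2) (by omega) (by omega) (by omega) (by omega)⟩
    · exact ⟨_, (hasPath_of_far hk hn hv hu (r := 2) (by omega) (by omega) (by omega)
        (by omega)).reverse⟩
  · obtain ⟨P, h⟩ := leaf v u hv hu (fun h => huv h.symm)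
    exact ⟨P, h.reverse⟩
  · exact leaf u v hu hv huv
  · have hij : (u.1 : ℕ) ≠ v.1 := fun h => hne (Fin.ext h)
    have h := (hasPath_hub_hub (n := n) hk hn (u.1.2.trans_le hκ) (v.1.2.trans_le hκ) hij).cons
      (ringGraph_adj_hub hk hκ hn hu) hu
    refine ⟨_, (h.snoc (ringGraph_adj_hub hk hκ hn hv).symm ?_).congr_length (by omega)⟩
    rintro (h | h)
    · exact hv h
    · exact hne (congrArg Prod.fst h).symm

theorem isSaturatedRel_ringGraph (hk : 3 ≤ k) (hκ : k ≤ D.κ) (hn : D.layers ≤ n) :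
    IsSaturatedRel (SimpleGraph.completeEquipartiteGraph k n) (SimpleGraph.cycleGraph D.ℓ)
      (D.ringGraph k n) where
  le := ringGraph_le hk
  free := ringGraph_free hk hκ hn
  contained_add_edge u v huv hnot := by
    rw [SimpleGraph.completeEquipartiteGraph_adj] at huv
    obtain ⟨P, h⟩ := hasPath_of_not_adj hk hκ hn huv hnot
    exact h.cycleGraph_isContained_sup_edge fun e => huv (congrArg Prod.fst e)

/-! ### The number of edges -/

variable (D) in
/-- The edge charged to a vertex: a leaf is charged with its edge, and a vertex of the ring with one
of the edges to the next layer. -/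
noncomputable def chargedEdge (v : Fin k × Fin n) : Sym2 (Fin k × Fin n) := by
  classical
  exact if D.OnRing v then s(v, D.emb k n ((v.2 : ℕ) + 1, 1 - (v.1 : ℕ)))
    else s(v, D.emb k n (hub v.1))

theorem card_edges_le :
    (D.ringGraph k n).edgeSet.encard ≤ ((k * n + D.layers + (3 + D.κ) * 5 : ℕ) : ℕ∞) := by
  classical
  have hroom := D.room; have hsize := D.size
  have hL : D.layers = D.ℓ + 1 := rfl
  -- the layers of the vertices of colour `2`
  let T : Finset ℕ := {0, D.q + 1, D.C} ∪ (Finset.range D.κ).image fun i => 6 * (i + 1)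
  -- the neighbours of such a vertex, apart from the one of its charged edge
  let O : Finset (ℕ × ℕ) :=
    {(D.layers - 1, 0), (D.layers - 1, 1), (0, 0), (0, 1), (1, 1)}
  let S : Finset (Sym2 (Fin k × Fin n)) := Finset.univ.image D.chargedEdge ∪
    (Finset.range D.layers).image (fun j => s(D.emb k n (j, 0), D.emb k n (j, 1))) ∪
    (T ×ˢ O).image fun t => s(D.emb k n (t.1, 2), D.emb k n (t.1 + t.2.1, t.2.2))
  have hcard : S.card ≤ k * n + D.layers + (3 + D.κ) * 5 := by
    refine (Finset.card_union_le _ _).trans (Nat.add_le_add ((Finset.card_union_le _ _).trans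
      (Nat.add_le_add ?_ ?_)) ?_)
    · exact Finset.card_image_le.trans (by simp)
    · exact Finset.card_image_le.trans (by simp)
    · refine Finset.card_image_le.trans ?_
      rw [Finset.card_product]
      refine Nat.mul_le_mul ((Finset.card_union_le _ _).trans (Nat.add_le_add
        Finset.card_le_three (Finset.card_image_le.trans (by simp)))) Finset.card_le_five
  have hT : ∀ v : Fin k × Fin n, D.OnRing v → (v.1 : ℕ) = 2 → (v.2 : ℕ) ∈ T := by
    rintro v ⟨-, ⟨h, -⟩ | ⟨-, h | h⟩⟩ hv
    · omega
    · refine Finset.mem_union_left _ ?_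
      simpa [IsCap] using h
    · refine Finset.mem_union_right _ (Finset.mem_image.2 ⟨(v.2 : ℕ) / 6 - 1, ?_⟩)
      unfold IsWide at h
      rw [Finset.mem_range]
      omega
  have charged : ∀ v, D.chargedEdge v ∈ S := fun v =>
    Finset.mem_union_left _ (Finset.mem_union_left _ (Finset.mem_image_of_mem _ (Finset.mem_univ v)))
  have two : ∀ v w : Fin k × Fin n, D.OnRing v → (v.1 : ℕ) = 2 → ∀ i,
      (i, (w.1 : ℕ)) ∈ O → ((v.2 : ℕ) + i) % D.layers = w.2 → s(v, w) ∈ S := by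
    intro v w hv hv2 i hi hw
    refine Finset.mem_union_right _ (Finset.mem_image.2 ⟨((v.2 : ℕ), (i, (w.1 : ℕ))),
      Finset.mk_mem_product (hT v hv hv2) hi, ?_⟩)
    dsimp only
    rw [emb_eq hw, ← hv2, emb_eq (Nat.mod_eq_of_lt hv.1)]
  have key : ∀ v w : Fin k × Fin n, D.OnRing v → D.OnRing w → v.1 ≠ w.1 →
      ((v.2 : ℕ) = w.2 ∨ (w.2 : ℕ) = (v.2 + 1) % D.layers) → s(v, w) ∈ S := by
    intro v w hv hw hne h
    have hne' : (v.1 : ℕ) ≠ w.1 := fun h => hne (Fin.ext h)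
    have hv2 := snd_le_two hv.core
    have hw2 := snd_le_two hw.core
    dsimp only at hv2 hw2
    have hvm := Nat.mod_eq_of_lt hv.1
    have hwm := Nat.mod_eq_of_lt hw.1
    by_cases hc : (w.1 : ℕ) = 1 - v.1 ∧ (w.2 : ℕ) = (v.2 + 1) % D.layers
    · have e : D.chargedEdge v = s(v, w) := by
        unfold chargedEdge
        rw [if_pos hv, ← hc.1, emb_eq hc.2.symm]
      exact e ▸ charged v
    · by_cases hv' : (v.1 : ℕ) = 2
      · rcases h with h | h
        · refine two v w hv hv' 0 ?_ (by rw [Nat.add_zero, hvm, h])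
          obtain hw' | hw' : (w.1 : ℕ) = 0 ∨ (w.1 : ℕ) = 1 := by omega
          all_goals simp [O, hw']
        · refine two v w hv hv' 1 ?_ h.symm
          have hw' : (w.1 : ℕ) = 1 := by
            have : (w.1 : ℕ) ≠ 0 := fun h0 => hc ⟨by omega, h⟩
            omega
          simp [O, hw']
      · by_cases hw' : (w.1 : ℕ) = 2
        · rw [Sym2.eq_swap]
          obtain hv'' | hv'' : (v.1 : ℕ) = 0 ∨ (v.1 : ℕ) = 1 := by omega
          all_goals
            rcases h with h | h
            · exact two w v hw hw' 0 (by simp [O, hv'']) (by rw [Nat.add_zero, hwm, h])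
            · refine two w v hw hw' (D.layers - 1) (by simp [O, hv'']) ?_
              rw [h, Nat.mod_add_mod, show (v.2 : ℕ) + 1 + (D.layers - 1) = v.2 + D.layers by omega,
                Nat.add_mod_right, hvm]
        · have h' : (v.2 : ℕ) = w.2 := h.resolve_right fun h => hc ⟨by omega, h⟩
          refine Finset.mem_union_left _ (Finset.mem_union_right _ (Finset.mem_image.2
            ⟨v.2, Finset.mem_range.2 hv.1, ?_⟩))
          obtain ⟨h0, h1⟩ | ⟨h0, h1⟩ : ((v.1 : ℕ) = 0 ∧ (w.1 : ℕ) = 1) ∨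
            ((v.1 : ℕ) = 1 ∧ (w.1 : ℕ) = 0) := by omega
          · rw [← h0, ← h1, emb_eq hvm, emb_eq (hvm.trans h')]
          · rw [← h0, ← h1, emb_eq hvm, emb_eq (hvm.trans h'), Sym2.eq_swap]
  have hleaf : ∀ v : Fin k × Fin n, ¬ D.OnRing v → s(v, D.emb k n (hub v.1)) ∈ S := fun v hv => by
    have e : D.chargedEdge v = s(v, D.emb k n (hub v.1)) := if_neg hv
    exact e ▸ charged v
  have hsub : (D.ringGraph k n).edgeSet ⊆ (S : Set (Sym2 (Fin k × Fin n))) := by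
    intro e
    induction e with
    | _ v w =>
    intro h
    rw [Finset.mem_coe]
    rcases ringGraph_adj_cases h with ⟨hv, hw, hne, h | h | h⟩ | ⟨hv, hw⟩ | ⟨hw, hv⟩
    · exact key v w hv hw hne (.inl h)
    · exact key v w hv hw hne (.inr h)
    · rw [Sym2.eq_swap]
      exact key w v hw hv hne.symm (.inr h)
    · rw [show w = D.emb k n (hub v.1) from hw]
      exact hleaf v hv
    · rw [Sym2.eq_swap, show v = D.emb k n (hub w.1) from hv]
      exact hleaf w hw
  refine (Set.encard_le_encard hsub).trans ?_
  rw [Set.encard_coe_eq_coe_finsetCard]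
  exact_mod_cast hcard

end RingParams

theorem satNumber_cycleGraph_le {k ℓ n : ℕ} (hk : 3 ≤ k) (hℓ : 60 * k + 12 ≤ ℓ) (hn : ℓ + 1 ≤ n) :
    satNumber (SimpleGraph.completeEquipartiteGraph k n) (SimpleGraph.cycleGraph ℓ)
      ≤ ((k * n + ℓ + 5 * k + 21 : ℕ) : ℕ∞) := by
  -- the number of wide layers is `k` or `k + 1`, by parity
  let D : RingParams :=
    { ℓ := ℓ
      κ := k + (ℓ - 3 - k) % 2
      q := (ℓ - 3 - (k + (ℓ - 3 - k) % 2)) / 2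
      C := (ℓ + 6) / 2
      size := by omega
      two_le := by omega
      room := by omega
      cap_lower := by omega
      cap_upper := by omega }
  have : NeZero k := ⟨by omega⟩
  have : NeZero n := ⟨by omega⟩
  have hκ : D.κ = k + (ℓ - 3 - k) % 2 := rfl
  have hL : D.layers = ℓ + 1 := rfl
  refine (iInf₂_le (D.ringGraph k n)
    (RingParams.isSaturatedRel_ringGraph hk (by omega) (by omega))).trans ?_
  refine RingParams.card_edges_le.trans ?_
  have : k * n + D.layers + (3 + D.κ) * 5 ≤ k * n + ℓ + 5 * k + 21 := by omega
  exact_mod_cast this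

theorem theorem1p10 :
    (∀ k ℓ : ℕ, 4 ≤ k → 60 * k + 12 ≤ ℓ → ∃ N : ℕ, ∀ n : ℕ, N ≤ n →
      satNumber (SimpleGraph.completeEquipartiteGraph k n) (SimpleGraph.cycleGraph ℓ)
        ≤ ((k * (n - 1) + 6 * ⌈(ℓ : ℚ) / 5⌉₊ : ℕ) : ℕ∞)) ∧
    (∀ ℓ : ℕ, 60 * 3 + 12 ≤ ℓ → ∃ N : ℕ, ∀ n : ℕ, N ≤ n →
      satNumber (SimpleGraph.completeEquipartiteGraph 3 n) (SimpleGraph.cycleGraph ℓ)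
        ≤ ((3 * n + 13 * ⌈(ℓ : ℚ) / 5⌉₊ : ℕ) : ℕ∞)) := by
  have hceil : ∀ ℓ : ℕ, ℓ ≤ 5 * ⌈(ℓ : ℚ) / 5⌉₊ := fun ℓ => by
    have h := Nat.le_ceil ((ℓ : ℚ) / 5)
    have h' : (ℓ : ℚ) ≤ 5 * (⌈(ℓ : ℚ) / 5⌉₊ : ℚ) := by linarith
    exact_mod_cast h'
  constructor
  · intro k ℓ hk hℓ
    refine ⟨ℓ + 1, fun n hn => (satNumber_cycleGraph_le (by omega) hℓ hn).trans ?_⟩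
    have h := hceil ℓ
    have e : k * n = k * (n - 1) + k := by
      obtain ⟨m, rfl⟩ : ∃ m, n = m + 1 := ⟨n - 1, by omega⟩
      rw [Nat.add_sub_cancel, Nat.mul_succ]
    have : k * n + ℓ + 5 * k + 21 ≤ k * (n - 1) + 6 * ⌈(ℓ : ℚ) / 5⌉₊ := by omega
    exact_mod_cast this
  · intro ℓ hℓ
    refine ⟨ℓ + 1, fun n hn => (satNumber_cycleGraph_le le_rfl hℓ hn).trans ?_⟩
    have h := hceil ℓ
    have : 3 * n + ℓ + 5 * 3 + 21 ≤ 3 * n + 13 * ⌈(ℓ : ℚ) / 5⌉₊ := by omega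
    exact_mod_cast this
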